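/- **Syntax of PVS-Cert.** The sorts are $\mathsf{Prop},\mathsf{Type},\mathsf{Kind}$, with axioms $(\mathsf{Prop},\mathsf{Type})$, $(\mathsf{Type},\mathsf{Kind})$ and product rules $(\mathsf{Prop},\mathsf{Prop},\mathsf{Prop})$, $(\mathsf{Type},\mathsf{Type},\mathsf{Type})$, $(\mathsf{Type},\mathsf{Prop},\mathsf{Prop})$. The terms are $$M,N,T,U,p,m,h ::= s \mid x \mid M\,N \mid \lambda x{:}T.\,M \mid \Pi x{:}T.\,U \mid \mathsf{psub}(T,p) \mid \mathsf{pair}(T,p,m,h) \mid \mathsf{fst}(T,p,m) \mid \mathsf{snd}(T,p,m),$$ where $s$ is a sort and $x$ a variable; variables are represented by de Bruijn indices, and $T\to U$ abbreviates $\Pi x{:}T.\,U$ with $x$ not free in $U$. **Equations.** For all terms, $$(\beta)\quad (\lambda x{:}T.\,M)\,N = M[x:=N],\qquad (\mathsf{fst})\quad \mathsf{fst}(t_0,u_0,\mathsf{pair}(t_1,u_1,m,h)) = m,$$ $$(pi)\quad \mathsf{pair}(t,u,m,h_0)=\mathsf{pair}(t,u,m,h_1).$$ Let $\hookrightarrow$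 be the union of the closures by substitution and context of $(\beta)$ and of $(\mathsf{fst})$, both oriented from left to right, and $\hookleftarrow$ its inverse. Let $\leftrightarrow_{pi}$ be the closure by substitution and context of $(pi)$, and ${=_{pi}}$ its reflexive and transitive closure. Let $\equiv$ be the equivalence relation on all terms (typable or not) generated by $\hookrightarrow$ and $\leftrightarrow_{pi}$. **Typing.** The judgements $\Gamma\vdash WF$ and $\Gamma\vdash M:T$ are defined by mutual induction by the following rules. * $\varnothing\vdash WF$; and if $\Gamma\vdash T:s$ then $\Gamma,v{:}T\vdash WF$, for $v$ a fresh variable. * If $\Gamma\vdash WF$ and $(v{:}T)\in\Gamma$, then $\Gamma\vdash v:T$. * If $\Gamma\vdash WF$ and $(s_1,s_2)$ is an axiom, then $\Gamma\vdash s_1:s_2$. * If $\Gamma\vdash M:U$, $\Gamma\vdash T:s$ and $T\equiv U$, then $\Gamma\vdash M:T$. * If $\Gamma\vdash T:s_1$, $\Gamma,x{:}T\vdash U:s_2$ and $(s_1,s_2,s_3)$ is a product rule, then $\Gamma\vdash \Pi x{:}T.\,U:s_3$. * If $\Gamma\vdash \Pi x{:}T.\,U:s$ and $\Gamma,x{:}T\vdash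 M:U$, then $\Gamma\vdash\lambda x{:}T.\,M:\Pi x{:}T.\,U$. * If $\Gamma\vdash M:\Pi x{:}T.\,U$ and $\Gamma\vdash N:T$, then $\Gamma\vdash M\,N:U[x:=N]$. * For each symbol $f$ with declaration $x_1{:}T_1,\dots,x_n{:}T_n\vdash f(x_1,\dots,x_n):U:s$ in the list below: if $x_1{:}T_1,\dots,x_n{:}T_n\vdash U:s$ and $\Gamma\vdash t_i:T_i[x_j:=t_j]_{j<i}$ for every $i$, then $\Gamma\vdash f(t_1,\dots,t_n):U[x_j:=t_j]_{j\le n}$. The declarations are $$\begin{aligned} T{:}\mathsf{Type},\ p{:}T\to\mathsf{Prop}&\vdash \mathsf{psub}(T,p):\mathsf{Type}:\mathsf{Kind}\\ T{:}\mathsf{Type},\ p{:}T\to\mathsf{Prop},\ m{:}T,\ h{:}p\,m&\vdash \mathsf{pair}(T,p,m,h):\mathsf{psub}(T,p):\mathsf{Type}\\ T{:}\mathsf{Type},\ p{:}T\to\mathsf{Prop},\ m{:}\mathsf{psub}(T,p)&\vdash \mathsf{fst}(T,p,m):T:\mathsf{Type}\\ T{:}\mathsf{Type},\ p{:}T\to\mathsf{Prop},\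 m{:}\mathsf{psub}(T,p)&\vdash \mathsf{snd}(T,p,m):p\,(\mathsf{fst}(T,p,m)):\mathsf{Prop}. \end{aligned}$$ A term $M$ is typable in $\Gamma$ if $\Gamma\vdash M:T$ for some $T$. For a set of terms $P$ and a relation $R$ on terms, $R^{P}$ is the restriction of $R$ to terms in $P$. Composition of relations is written by juxtaposition: $t\,RS\,u$ means that $t\,R\,v$ and $v\,S\,u$ for some $v$. **Lemma (Properties of the PVS-Cert conversion).** 1. $\hookrightarrow$ is confluent modulo $=_{pi}$, that is, ${\hookleftarrow^*\hookrightarrow^*}\subseteq{\hookrightarrow^*\,{=_{pi}}\,\hookleftarrow^*}$, and moreover ${\equiv}\subseteq{\hookrightarrow^*\,{=_{pi}}\,\hookleftarrow^*}$. 2. $\hookrightarrow$ preserves typing: if $\Gamma\vdash M:T$ and $M\hookrightarrow M'$, then $\Gamma\vdash M':T$. 3. For every context $\Gamma$, with $P$ the set of terms typable in $\Gamma$, $${\equiv^{P}}\subseteq{(\hookrightarrow^{P})^*\,(\leftrightarrow_{pi}^{P})^*\,(\hookleftarrow^{P})^*},$$ and the same inclusion holds when $P$ is the set of terms that are typable in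 some context. -/

import Mathlib

namespace PVSCert

/-- The sorts of PVS-Cert (those of simple type theory presented as a pure type system). -/
inductive Srt : Type
  | prop
  | type
  | kind

/-- The axioms (Prop, Type) and (Type, Kind). -/
inductive Srt.Ax : Srt → Srt → Prop
  | prop_type : Srt.Ax Srt.prop Srt.type
  | type_kind : Srt.Ax Srt.type Srt.kind

/-- The product rules (Prop, Prop, Prop), (Type, Type, Type) and (Type, Prop, Prop). -/
inductive Srt.Rule : Srt → Srt → Srt → Prop
  | prop_prop : Srt.Rule Srt.prop Srt.prop Srt.prop
  | type_type : Srt.Rule Srt.type Srt.type Srt.type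
  | type_prop : Srt.Rule Srt.type Srt.prop Srt.prop

/-- Terms, with de Bruijn indices for variables: `lam T M` and `pi T U` bind the index `0` in `M`
and in `U`. The last four constructors are the function symbols of the signature. -/
inductive Term : Type
  | sort (s : Srt)
  | var (n : ℕ)
  | app (M N : Term)
  | lam (T M : Term)
  | pi (T U : Term)
  | psub (T p : Term)
  | pair (T p m h : Term)
  | fst (T p m : Term)
  | snd (T p m : Term)

namespace Term

/-- The extension of a renaming under one binder. -/
def upRen (ρ : ℕ → ℕ) : ℕ → ℕ
  | 0 => 0
  | n + 1 => ρ n + 1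

/-- Renaming of the free variables. -/
def rename (ρ : ℕ → ℕ) : Term → Term
  | sort s => sort s
  | var n => var (ρ n)
  | app M N => app (M.rename ρ) (N.rename ρ)
  | lam T M => lam (T.rename ρ) (M.rename (upRen ρ))
  | pi T U => pi (T.rename ρ) (U.rename (upRen ρ))
  | psub T p => psub (T.rename ρ) (p.rename ρ)
  | pair T p m h => pair (T.rename ρ) (p.rename ρ) (m.rename ρ) (h.rename ρ)
  | fst T p m => fst (T.rename ρ) (p.rename ρ) (m.rename ρ)
  | snd T p m => snd (T.rename ρ) (p.rename ρ) (m.rename ρ)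

/-- Weakening: all free indices are shifted by one. -/
def lift (M : Term) : Term := M.rename Nat.succ

/-- The extension of a substitution under one binder. -/
def upSubst (σ : ℕ → Term) : ℕ → Term
  | 0 => var 0
  | n + 1 => (σ n).lift

/-- Capture-avoiding parallel substitution. -/
def subst (σ : ℕ → Term) : Term → Term
  | sort s => sort s
  | var n => σ n
  | app M N => app (M.subst σ) (N.subst σ)
  | lam T M => lam (T.subst σ) (M.subst (upSubst σ))
  | pi T U => pi (T.subst σ) (U.subst (upSubst σ))
  | psub T p => psub (T.subst σ) (p.subst σ)
  | pair T p m h => pair (T.subst σ) (p.subst σ) (m.subst σ) (h.subst σ)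
  | fst T p m => fst (T.subst σ) (p.subst σ) (m.subst σ)
  | snd T p m => snd (T.subst σ) (p.subst σ) (m.subst σ)

/-- The substitution that sends the index `0` to `N` and lowers the other indices by one. -/
def single (N : Term) : ℕ → Term
  | 0 => N
  | n + 1 => var n

/-- `M.inst N` is `M` with `N` substituted for its outermost bound variable (the index `0`). -/
def inst (M N : Term) : Term := M.subst (single N)

end Term

open Term

/-- The equation beta, oriented from left to right, at the root of a term. -/
inductive BetaRoot : Term → Term → Prop
  | mk (T M N : Term) : BetaRoot (app (lam T M) N) (M.inst N)

/-- The first projection equation, oriented from left to right, at the root of a term. -/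
inductive FstRoot : Term → Term → Prop
  | mk (t₀ u₀ t₁ u₁ m h : Term) : FstRoot (fst t₀ u₀ (pair t₁ u₁ m h)) m

/-- The proof irrelevance equation at the root of a term. -/
inductive PiRoot : Term → Term → Prop
  | mk (t u m h₀ h₁ : Term) : PiRoot (pair t u m h₀) (pair t u m h₁)

/-- The closure of a relation by contexts: `R` is applied once, at one position of the term.
(The three relations above are schematic in their terms, so that their closure by contexts is
already closed by substitution.) -/
inductive CtxClosure (R : Term → Term → Prop) : Term → Term → Prop
  | root {M N : Term} : R M N → CtxClosure R M N
  | app_left {M M' : Term} (N : Term) :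
      CtxClosure R M M' → CtxClosure R (app M N) (app M' N)
  | app_right (M : Term) {N N' : Term} :
      CtxClosure R N N' → CtxClosure R (app M N) (app M N')
  | lam_dom {T T' : Term} (M : Term) :
      CtxClosure R T T' → CtxClosure R (lam T M) (lam T' M)
  | lam_body (T : Term) {M M' : Term} :
      CtxClosure R M M' → CtxClosure R (lam T M) (lam T M')
  | pi_dom {T T' : Term} (U : Term) :
      CtxClosure R T T' → CtxClosure R (pi T U) (pi T' U)
  | pi_cod (T : Term) {U U' : Term} :
      CtxClosure R U U' → CtxClosure R (pi T U) (pi T U')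
  | psub_type {T T' : Term} (p : Term) :
      CtxClosure R T T' → CtxClosure R (psub T p) (psub T' p)
  | psub_pred (T : Term) {p p' : Term} :
      CtxClosure R p p' → CtxClosure R (psub T p) (psub T p')
  | pair_type {T T' : Term} (p m h : Term) :
      CtxClosure R T T' → CtxClosure R (pair T p m h) (pair T' p m h)
  | pair_pred (T : Term) {p p' : Term} (m h : Term) :
      CtxClosure R p p' → CtxClosure R (pair T p m h) (pair T p' m h)
  | pair_elem (T p : Term) {m m' : Term} (h : Term) :
      CtxClosure R m m' → CtxClosure R (pair T p m h) (pair T p m' h)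
  | pair_proof (T p m : Term) {h h' : Term} :
      CtxClosure R h h' → CtxClosure R (pair T p m h) (pair T p m h')
  | fst_type {T T' : Term} (p m : Term) :
      CtxClosure R T T' → CtxClosure R (fst T p m) (fst T' p m)
  | fst_pred (T : Term) {p p' : Term} (m : Term) :
      CtxClosure R p p' → CtxClosure R (fst T p m) (fst T p' m)
  | fst_arg (T p : Term) {m m' : Term} :
      CtxClosure R m m' → CtxClosure R (fst T p m) (fst T p m')
  | snd_type {T T' : Term} (p m : Term) :
      CtxClosure R T T' → CtxClosure R (snd T p m) (snd T' p m)
  | snd_pred (T : Term) {p p' : Term} (m : Term) :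
      CtxClosure R p p' → CtxClosure R (snd T p m) (snd T p' m)
  | snd_arg (T p : Term) {m m' : Term} :
      CtxClosure R m m' → CtxClosure R (snd T p m) (snd T p m')

/-- One step of beta or first projection reduction. -/
def Red (M N : Term) : Prop := CtxClosure BetaRoot M N ∨ CtxClosure FstRoot M N

/-- One proof irrelevance step. -/
def PiStep : Term → Term → Prop := CtxClosure PiRoot

/-- Equality modulo proof irrelevance: the reflexive and transitive closure of `PiStep`. -/
def PiEq : Term → Term → Prop := Relation.ReflTransGen PiStep

/-- The conversion of PVS-Cert: the equivalence relation generated by the closure by contexts of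
the equations beta, first projection and proof irrelevance, on all terms, typable or not. -/
def Conv : Term → Term → Prop :=
  Relation.EqvGen fun M N =>
    CtxClosure BetaRoot M N ∨ CtxClosure FstRoot M N ∨ CtxClosure PiRoot M N

/-- Contexts; the head of the list is the declaration made last. The type of a declaration lives
in the rest of the list. -/
abbrev Ctx : Type := List Term

/-- `Lookup Γ n T`: the `n`-th variable is declared in `Γ` with type `T`, lifted to `Γ`. -/
inductive Lookup : Ctx → ℕ → Term → Prop
  | zero (Γ : Ctx) (T : Term) : Lookup (T :: Γ) 0 T.lift
  | succ {Γ : Ctx} {n : ℕ} {T : Term} (U : Term) : Lookup Γ n T → Lookup (U :: Γ) (n + 1) T.lift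

/-- The context `T : Type, p : T → Prop` of the symbol `psub`. -/
def sigPsub : Ctx := [pi (var 0) (sort Srt.prop), sort Srt.type]

/-- The context `T : Type, p : T → Prop, m : T, h : p m` of the symbol `pair`. -/
def sigPair : Ctx := app (var 1) (var 0) :: var 1 :: sigPsub

/-- The context `T : Type, p : T → Prop, m : psub T p` of the symbols `fst` and `snd`. -/
def sigProj : Ctx := psub (var 1) (var 0) :: sigPsub

mutual

/-- Well-formed contexts. -/
inductive WF : Ctx → Prop
  | empty : WF []
  | decl {Γ : Ctx} {T : Term} {s : Srt} : HasType Γ T (sort s) → WF (T :: Γ)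

/-- The typing judgement of PVS-Cert. The last four rules are the instances of the rule for
applied function symbols; their first premise types the result type of the symbol in its own
context. -/
inductive HasType : Ctx → Term → Term → Prop
  | var {Γ : Ctx} {n : ℕ} {T : Term} : WF Γ → Lookup Γ n T → HasType Γ (var n) T
  | conv {Γ : Ctx} {M T U : Term} {s : Srt} :
      HasType Γ M U → HasType Γ T (sort s) → Conv T U → HasType Γ M T
  | sort {Γ : Ctx} {s₁ s₂ : Srt} :
      WF Γ → Srt.Ax s₁ s₂ → HasType Γ (sort s₁) (sort s₂)
  | prod {Γ : Ctx} {T U : Term} {s₁ s₂ s₃ : Srt} :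
      Srt.Rule s₁ s₂ s₃ → HasType Γ T (sort s₁) → HasType (T :: Γ) U (sort s₂) →
      HasType Γ (pi T U) (sort s₃)
  | abst {Γ : Ctx} {T U M : Term} {s : Srt} :
      HasType Γ (pi T U) (sort s) → HasType (T :: Γ) M U → HasType Γ (lam T M) (pi T U)
  | app {Γ : Ctx} {M N T U : Term} :
      HasType Γ M (pi T U) → HasType Γ N T → HasType Γ (app M N) (U.inst N)
  | psub {Γ : Ctx} {T p : Term} :
      HasType sigPsub (sort Srt.type) (sort Srt.kind) →
      HasType Γ T (sort Srt.type) → HasType Γ p (pi T (sort Srt.prop)) →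
      HasType Γ (psub T p) (sort Srt.type)
  | pair {Γ : Ctx} {T p m h : Term} :
      HasType sigPair (psub (var 3) (var 2)) (sort Srt.type) →
      HasType Γ T (sort Srt.type) → HasType Γ p (pi T (sort Srt.prop)) →
      HasType Γ m T → HasType Γ h (app p m) →
      HasType Γ (pair T p m h) (psub T p)
  | fst {Γ : Ctx} {T p m : Term} :
      HasType sigProj (var 2) (sort Srt.type) →
      HasType Γ T (sort Srt.type) → HasType Γ p (pi T (sort Srt.prop)) →
      HasType Γ m (psub T p) →
      HasType Γ (fst T p m) T
  | snd {Γ : Ctx} {T p m : Term} :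
      HasType sigProj (app (var 1) (fst (var 2) (var 1) (var 0))) (sort Srt.prop) →
      HasType Γ T (sort Srt.type) → HasType Γ p (pi T (sort Srt.prop)) →
      HasType Γ m (psub T p) →
      HasType Γ (snd T p m) (app p (fst T p m))

end

/-- `M` is typable in the context `Γ`. -/
def TypableIn (Γ : Ctx) (M : Term) : Prop := ∃ T, HasType Γ M T

/-- `M` is typable in some context. -/
def Typable (M : Term) : Prop := ∃ Γ, TypableIn Γ M

/-- The restriction of a relation to the terms that satisfy `P`. -/
def Restrict (P : Term → Prop) (R : Term → Term → Prop) (M N : Term) : Prop :=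
  P M ∧ P N ∧ R M N

end PVSCert

open PVSCert

/-!
Reduction is an orthogonal system, so it is confluent by parallel reduction: every term has a
complete development, which all its parallel reducts reach in one step
(`Par.exists_development`, `Reds.confluent`). Proof irrelevance is equality of the terms obtained by
erasing the proofs in pairs (`PiStep.erase_eq`, `PiEq.of_erase_eq`), and reduction commutes with it
because the proof of a pair is never part of a redex pattern (`Reds.lift_erase`). Hence convertible
terms have reducts with the same erasure (`Conv.exists_reds`), which gives the injectivity of `pi`
and `psub` up to conversion.

With injectivity, subject reduction (`HasType.red`) follows from the substitution lemma, the
replacement of the last declaration of a context by a convertible one, the validity of types, and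
one typed congruence lemma for each constructor: a subterm may be replaced by a convertible subterm
of the same type without a change of the type of the whole term.

It remains to connect typable terms with the same erasure by proof irrelevance steps between typable
terms. In a fixed context, the proofs of the second term are put into the first one from left to
right, and the typed congruence lemmas type the intermediate terms (`HasType.piPath`). When the two
terms are only known to be typable in unrelated contexts, a term with proofs from both need not be
typable in either. Both contexts are then extended, at their outer ends, by declarations of type
`Π P : Prop. P`, up to the same length. The outermost variable, which has the same index in both,
proves every proposition, so that each term is connected, in its own context, to the term where the
proof in each pair is a canonical one built from that variable (`Term.fill`). This filled term
depends only on the erasure, and hence is common to both (`Typable.piStep_path`).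
-/

namespace PVSCert

open Term

/-! ### Substitution calculus -/

namespace Term

theorem upRen_comp (ρ ρ' : ℕ → ℕ) : (fun n => upRen ρ' (upRen ρ n)) = upRen fun n => ρ' (ρ n) := by
  funext n; cases n <;> rfl

theorem rename_rename (M : Term) (ρ ρ' : ℕ → ℕ) :
    (M.rename ρ).rename ρ' = M.rename fun n => ρ' (ρ n) := by
  induction M generalizing ρ ρ' <;> simp_all [rename, upRen_comp]

theorem upSubst_comp_upRen (ρ : ℕ → ℕ) (σ : ℕ → Term) :
    (fun n => upSubst σ (upRen ρ n)) = upSubst fun n => σ (ρ n) := by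
  funext n; cases n <;> rfl

theorem subst_rename (M : Term) (ρ : ℕ → ℕ) (σ : ℕ → Term) :
    (M.rename ρ).subst σ = M.subst fun n => σ (ρ n) := by
  induction M generalizing ρ σ <;> simp_all [rename, subst, upSubst_comp_upRen]

theorem lift_rename (M : Term) (ρ : ℕ → ℕ) : (M.rename ρ).lift = M.lift.rename (upRen ρ) := by
  simp [lift, rename_rename, upRen]

theorem rename_upSubst (σ : ℕ → Term) (ρ : ℕ → ℕ) :
    (fun n => (upSubst σ n).rename (upRen ρ)) = upSubst fun n => (σ n).rename ρ := by
  funext n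
  cases n
  · rfl
  · simp [upSubst, lift_rename]

theorem rename_subst (M : Term) (σ : ℕ → Term) (ρ : ℕ → ℕ) :
    (M.subst σ).rename ρ = M.subst fun n => (σ n).rename ρ := by
  induction M generalizing ρ σ <;> simp_all [rename, subst, rename_upSubst]

theorem lift_subst (M : Term) (σ : ℕ → Term) : (M.subst σ).lift = M.lift.subst (upSubst σ) := by
  simp [lift, rename_subst, subst_rename, upSubst]

theorem upSubst_subst (σ τ : ℕ → Term) :
    (fun n => (upSubst σ n).subst (upSubst τ)) = upSubst fun n => (σ n).subst τ := by
  funext n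
  cases n
  · rfl
  · simp [upSubst, lift_subst]

theorem subst_subst (M : Term) (σ τ : ℕ → Term) :
    (M.subst σ).subst τ = M.subst fun n => (σ n).subst τ := by
  induction M generalizing σ τ <;> simp_all [subst, upSubst_subst]

theorem upSubst_var : upSubst var = var := by
  funext n; cases n <;> rfl

theorem subst_var (M : Term) : M.subst var = M := by
  induction M <;> simp_all [subst, upSubst_var]

theorem rename_eq_subst (M : Term) (ρ : ℕ → ℕ) : M.rename ρ = M.subst fun n => var (ρ n) := by
  rw [← subst_var (M.rename ρ), subst_rename]

theorem rename_id (M : Term) : M.rename (fun n => n) = M := by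
  rw [rename_eq_subst]; exact subst_var M

theorem lift_subst_single (M N : Term) : M.lift.subst (single N) = M := by
  rw [lift, subst_rename]; exact subst_var M

theorem inst_subst (M N : Term) (σ : ℕ → Term) :
    (M.inst N).subst σ = (M.subst (upSubst σ)).inst (N.subst σ) := by
  simp only [inst, subst_subst]
  congr 1
  funext n
  cases n
  · rfl
  · simp [upSubst, single, subst, lift_subst_single]

theorem inst_rename (M N : Term) (ρ : ℕ → ℕ) :
    (M.inst N).rename ρ = (M.rename (upRen ρ)).inst (N.rename ρ) := by
  simp only [inst, rename_subst, subst_rename]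
  congr 1
  funext n
  cases n <;> rfl

end Term

/-! ### Closure by contexts and reduction -/

theorem CtxClosure.mono {R S : Term → Term → Prop} (h : ∀ M N, R M N → S M N) {M N : Term}
    (hMN : CtxClosure R M N) : CtxClosure S M N := by
  induction hMN <;> grind [CtxClosure]

theorem CtxClosure.subst {R : Term → Term → Prop}
    (hR : ∀ M N σ, R M N → R (M.subst σ) (N.subst σ)) {M N : Term} (h : CtxClosure R M N)
    (σ : ℕ → Term) : CtxClosure R (M.subst σ) (N.subst σ) := by
  induction h generalizing σ <;> grind [CtxClosure, Term.subst]

/-- One step of reduction at the root of a term. -/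
def RedRoot (M N : Term) : Prop := BetaRoot M N ∨ FstRoot M N

theorem red_iff {M N : Term} : Red M N ↔ CtxClosure RedRoot M N := by
  constructor
  · rintro (h | h)
    · exact h.mono fun _ _ => Or.inl
    · exact h.mono fun _ _ => Or.inr
  · unfold Red
    intro h
    induction h <;> grind [CtxClosure, RedRoot]

/-- The reflexive and transitive closure of reduction. -/
abbrev Reds : Term → Term → Prop := Relation.ReflTransGen Red

theorem Reds.map {f : Term → Term}
    (hf : ∀ M N, CtxClosure RedRoot M N → CtxClosure RedRoot (f M) (f N)) {M N : Term}
    (h : Reds M N) : Reds (f M) (f N) :=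
  Relation.ReflTransGen.lift f (fun _ _ h => red_iff.2 (hf _ _ (red_iff.1 h))) _ _ h

theorem Reds.app {M M' N N' : Term} (h₁ : Reds M M') (h₂ : Reds N N') :
    Reds (app M N) (app M' N') :=
  (h₁.map fun _ _ => .app_left N).trans (h₂.map fun _ _ => .app_right M')

theorem Reds.lam {T T' M M' : Term} (h₁ : Reds T T') (h₂ : Reds M M') :
    Reds (lam T M) (lam T' M') :=
  (h₁.map fun _ _ => .lam_dom M).trans (h₂.map fun _ _ => .lam_body T')

theorem Reds.pi {T T' U U' : Term} (h₁ : Reds T T') (h₂ : Reds U U') :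
    Reds (pi T U) (pi T' U') :=
  (h₁.map fun _ _ => .pi_dom U).trans (h₂.map fun _ _ => .pi_cod T')

theorem Reds.psub {T T' p p' : Term} (h₁ : Reds T T') (h₂ : Reds p p') :
    Reds (psub T p) (psub T' p') :=
  (h₁.map fun _ _ => .psub_type p).trans (h₂.map fun _ _ => .psub_pred T')

theorem Reds.pair {T T' p p' m m' h h' : Term} (h₁ : Reds T T') (h₂ : Reds p p')
    (h₃ : Reds m m') (h₄ : Reds h h') : Reds (pair T p m h) (pair T' p' m' h') :=
  (((h₁.map fun _ _ => .pair_type p m h).trans (h₂.map fun _ _ => .pair_pred T' m h)).trans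
    (h₃.map fun _ _ => .pair_elem T' p' h)).trans (h₄.map fun _ _ => .pair_proof T' p' m')

theorem Reds.fst {T T' p p' m m' : Term} (h₁ : Reds T T') (h₂ : Reds p p') (h₃ : Reds m m') :
    Reds (fst T p m) (fst T' p' m') :=
  ((h₁.map fun _ _ => .fst_type p m).trans (h₂.map fun _ _ => .fst_pred T' m)).trans
    (h₃.map fun _ _ => .fst_arg T' p')

theorem Reds.snd {T T' p p' m m' : Term} (h₁ : Reds T T') (h₂ : Reds p p') (h₃ : Reds m m') :
    Reds (snd T p m) (snd T' p' m') :=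
  ((h₁.map fun _ _ => .snd_type p m).trans (h₂.map fun _ _ => .snd_pred T' m)).trans
    (h₃.map fun _ _ => .snd_arg T' p')

/-! ### Confluence of reduction -/

/-- Parallel reduction: any set of the redexes present in a term is contracted at once. -/
inductive Par : Term → Term → Prop
  | sort (s : Srt) : Par (sort s) (sort s)
  | var (n : ℕ) : Par (var n) (var n)
  | app {M M' N N' : Term} : Par M M' → Par N N' → Par (app M N) (app M' N')
  | lam {T T' M M' : Term} : Par T T' → Par M M' → Par (lam T M) (lam T' M')
  | pi {T T' U U' : Term} : Par T T' → Par U U' → Par (pi T U) (pi T' U')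
  | psub {T T' p p' : Term} : Par T T' → Par p p' → Par (psub T p) (psub T' p')
  | pair {T T' p p' m m' h h' : Term} : Par T T' → Par p p' → Par m m' → Par h h' →
      Par (pair T p m h) (pair T' p' m' h')
  | fst {T T' p p' m m' : Term} : Par T T' → Par p p' → Par m m' →
      Par (fst T p m) (fst T' p' m')
  | snd {T T' p p' m m' : Term} : Par T T' → Par p p' → Par m m' →
      Par (snd T p m) (snd T' p' m')
  | beta {T M M' N N' : Term} : Par M M' → Par N N' → Par (app (lam T M) N) (M'.inst N')
  | fst_pair {t₀ u₀ t₁ u₁ m m' h : Term} : Par m m' → Par (fst t₀ u₀ (pair t₁ u₁ m h)) m'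

namespace Par

theorem refl (M : Term) : Par M M := by
  induction M <;> constructor <;> assumption

theorem of_red {M N : Term} (h : Red M N) : Par M N := by
  rw [red_iff] at h
  induction h with
  | root h =>
    rcases h with ⟨T, M, N⟩ | ⟨t₀, u₀, t₁, u₁, m, h⟩
    · exact .beta (refl _) (refl _)
    · exact .fst_pair (refl _)
  | _ => constructor <;> first | assumption | exact refl _

theorem reds {M N : Term} (h : Par M N) : Reds M N := by
  induction h with
  | sort | var => exact .refl
  | app _ _ h₁ h₂ => exact h₁.app h₂
  | lam _ _ h₁ h₂ => exact h₁.lam h₂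
  | pi _ _ h₁ h₂ => exact h₁.pi h₂
  | psub _ _ h₁ h₂ => exact h₁.psub h₂
  | pair _ _ _ _ h₁ h₂ h₃ h₄ => exact h₁.pair h₂ h₃ h₄
  | fst _ _ _ h₁ h₂ h₃ => exact h₁.fst h₂ h₃
  | snd _ _ _ h₁ h₂ h₃ => exact h₁.snd h₂ h₃
  | beta _ _ h₁ h₂ =>
    exact ((Reds.lam .refl h₁).app h₂).tail (Or.inl (.root (.mk _ _ _)))
  | fst_pair _ h₁ =>
    exact (Reds.fst .refl .refl (.pair .refl .refl h₁ .refl)).tail (Or.inr (.root (.mk ..)))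

theorem rename {M N : Term} (h : Par M N) (ρ : ℕ → ℕ) : Par (M.rename ρ) (N.rename ρ) := by
  induction h generalizing ρ with
  | beta _ _ h₁ h₂ => rw [inst_rename]; exact .beta (h₁ _) (h₂ _)
  | fst_pair _ h₁ => exact .fst_pair (h₁ _)
  | _ => simp only [Term.rename]; constructor <;> apply_assumption

theorem upSubst {σ τ : ℕ → Term} (h : ∀ n, Par (σ n) (τ n)) (n : ℕ) :
    Par (upSubst σ n) (upSubst τ n) := by
  cases n
  · exact .var 0
  · exact (h _).rename _

theorem subst {M N : Term} (h : Par M N) {σ τ : ℕ → Term} (hσ : ∀ n, Par (σ n) (τ n)) :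
    Par (M.subst σ) (N.subst τ) := by
  induction h generalizing σ τ with
  | var n => exact hσ n
  | sort s => exact .sort s
  | app _ _ h₁ h₂ => exact .app (h₁ hσ) (h₂ hσ)
  | lam _ _ h₁ h₂ => exact .lam (h₁ hσ) (h₂ (upSubst hσ))
  | pi _ _ h₁ h₂ => exact .pi (h₁ hσ) (h₂ (upSubst hσ))
  | psub _ _ h₁ h₂ => exact .psub (h₁ hσ) (h₂ hσ)
  | pair _ _ _ _ h₁ h₂ h₃ h₄ => exact .pair (h₁ hσ) (h₂ hσ) (h₃ hσ) (h₄ hσ)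
  | fst _ _ _ h₁ h₂ h₃ => exact .fst (h₁ hσ) (h₂ hσ) (h₃ hσ)
  | snd _ _ _ h₁ h₂ h₃ => exact .snd (h₁ hσ) (h₂ hσ) (h₃ hσ)
  | beta _ _ h₁ h₂ => rw [inst_subst]; exact .beta (h₁ (upSubst hσ)) (h₂ hσ)
  | fst_pair _ h₁ => exact .fst_pair (h₁ hσ)

theorem inst {M M' N N' : Term} (hM : Par M M') (hN : Par N N') :
    Par (M.inst N) (M'.inst N') :=
  hM.subst fun n => by
    cases n
    · exact hN
    · exact .var _

/-- Every term has a complete development, which all its parallel reducts reach in one parallel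
step. -/
theorem exists_development (M : Term) : ∃ D, ∀ N, Par M N → Par N D := by
  induction M with
  | sort s => exact ⟨_, fun N h => by cases h; exact .sort s⟩
  | var n => exact ⟨_, fun N h => by cases h; exact .var n⟩
  | lam T M h₁ h₂ =>
    obtain ⟨D₁, h₁⟩ := h₁; obtain ⟨D₂, h₂⟩ := h₂
    exact ⟨.lam D₁ D₂, fun N h => by cases h with | lam a b => exact .lam (h₁ _ a) (h₂ _ b)⟩
  | pi T M h₁ h₂ =>
    obtain ⟨D₁, h₁⟩ := h₁; obtain ⟨D₂, h₂⟩ := h₂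
    exact ⟨.pi D₁ D₂, fun N h => by cases h with | pi a b => exact .pi (h₁ _ a) (h₂ _ b)⟩
  | psub T M h₁ h₂ =>
    obtain ⟨D₁, h₁⟩ := h₁; obtain ⟨D₂, h₂⟩ := h₂
    exact ⟨.psub D₁ D₂, fun N h => by cases h with | psub a b => exact .psub (h₁ _ a) (h₂ _ b)⟩
  | pair T p m q h₁ h₂ h₃ h₄ =>
    obtain ⟨D₁, h₁⟩ := h₁; obtain ⟨D₂, h₂⟩ := h₂; obtain ⟨D₃, h₃⟩ := h₃; obtain ⟨D₄, h₄⟩ := h₄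
    exact ⟨.pair D₁ D₂ D₃ D₄, fun N h => by
      cases h with | pair a b c d => exact .pair (h₁ _ a) (h₂ _ b) (h₃ _ c) (h₄ _ d)⟩
  | snd T p m h₁ h₂ h₃ =>
    obtain ⟨D₁, h₁⟩ := h₁; obtain ⟨D₂, h₂⟩ := h₂; obtain ⟨D₃, h₃⟩ := h₃
    exact ⟨.snd D₁ D₂ D₃, fun N h => by
      cases h with | snd a b c => exact .snd (h₁ _ a) (h₂ _ b) (h₃ _ c)⟩
  | app M N h₁ h₂ =>
    obtain ⟨D₁, h₁⟩ := h₁; obtain ⟨D₂, h₂⟩ := h₂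
    by_cases hM : ∃ T B, M = .lam T B
    · obtain ⟨T, B, rfl⟩ := hM
      -- the development of an abstraction is an abstraction, of which the body is a development
      cases h₁ _ (refl _) with
      | @lam _ E₁ _ E₂ _ _ =>
      have hB : ∀ B', Par B B' → Par B' E₂ := fun B' hb => by
        cases h₁ _ (.lam (refl T) hb) with | lam _ b => exact b
      refine ⟨E₂.inst D₂, fun P h => ?_⟩
      cases h with
      | app a b => cases a with | lam _ a => exact .beta (hB _ a) (h₂ _ b)
      | beta a b => exact (hB _ a).inst (h₂ _ b)
    · refine ⟨.app D₁ D₂, fun P h => ?_⟩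
      cases h with
      | app a b => exact .app (h₁ _ a) (h₂ _ b)
      | beta a b => exact absurd ⟨_, _, rfl⟩ hM
  | fst T p m h₁ h₂ h₃ =>
    obtain ⟨D₁, h₁⟩ := h₁; obtain ⟨D₂, h₂⟩ := h₂; obtain ⟨D₃, h₃⟩ := h₃
    by_cases hm : ∃ t u n q, m = .pair t u n q
    · obtain ⟨t, u, n, q, rfl⟩ := hm
      cases h₃ _ (refl _) with
      | @pair _ E₁ _ E₂ _ E₃ _ E₄ _ _ _ _ =>
      have hn : ∀ n', Par n n' → Par n' E₃ := fun n' hb => by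
        cases h₃ _ (.pair (refl t) (refl u) hb (refl q)) with | pair _ _ b _ => exact b
      refine ⟨E₃, fun P h => ?_⟩
      cases h with
      | fst a b c => cases c with | pair _ _ c _ => exact .fst_pair (hn _ c)
      | fst_pair a => exact hn _ a
    · refine ⟨.fst D₁ D₂ D₃, fun P h => ?_⟩
      cases h with
      | fst a b c => exact .fst (h₁ _ a) (h₂ _ b) (h₃ _ c)
      | fst_pair a => exact absurd ⟨_, _, _, _, rfl⟩ hm

end Par

theorem reds_iff_par {M N : Term} : Reds M N ↔ Relation.ReflTransGen Par M N := by
  constructor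
  · exact Relation.ReflTransGen.mono (fun _ _ => Par.of_red) _ _
  · intro h
    induction h with
    | refl => exact .refl
    | tail _ h ih => exact ih.trans h.reds

theorem Reds.confluent {M A B : Term} (hA : Reds M A) (hB : Reds M B) :
    ∃ C, Reds A C ∧ Reds B C := by
  rw [reds_iff_par] at hA hB
  obtain ⟨C, h₁, h₂⟩ := Relation.church_rosser (fun a b c hb hc => by
    obtain ⟨D, hD⟩ := Par.exists_development a
    exact ⟨D, .single (hD _ hb), .single (hD _ hc)⟩) hA hB
  exact ⟨C, reds_iff_par.2 h₁, reds_iff_par.2 h₂⟩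

/-! ### Erasure of proofs and the conversion -/

namespace Term

/-- The erasure of the proofs in the pairs of a term: the last argument of every `pair` is
replaced by the same closed normal term, here the sort `prop`. -/
def erase : Term → Term
  | sort s => sort s
  | var n => var n
  | app M N => app M.erase N.erase
  | lam T M => lam T.erase M.erase
  | pi T U => pi T.erase U.erase
  | psub T p => psub T.erase p.erase
  | pair T p m _ => pair T.erase p.erase m.erase (sort Srt.prop)
  | fst T p m => fst T.erase p.erase m.erase
  | snd T p m => snd T.erase p.erase m.erase

theorem erase_rename (M : Term) (ρ : ℕ → ℕ) : (M.rename ρ).erase = M.erase.rename ρ := by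
  induction M generalizing ρ <;> simp_all [rename, erase]

theorem erase_upSubst (σ : ℕ → Term) :
    (fun n => (upSubst σ n).erase) = upSubst fun n => (σ n).erase := by
  funext n
  cases n
  · rfl
  · simp [upSubst, lift, erase_rename]

theorem erase_subst (M : Term) (σ : ℕ → Term) :
    (M.subst σ).erase = M.erase.subst fun n => (σ n).erase := by
  induction M generalizing σ <;> simp_all [subst, erase, erase_upSubst]

theorem erase_inst (M N : Term) : (M.inst N).erase = M.erase.inst N.erase := by
  rw [inst, inst, erase_subst]
  congr 1
  funext n
  cases n <;> rfl

end Term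

theorem PiStep.erase_eq {M N : Term} (h : PiStep M N) : M.erase = N.erase := by
  induction h with
  | root h => cases h; rfl
  | _ => simp_all [erase]

theorem PiEq.map {f : Term → Term} (hf : ∀ M N, PiStep M N → PiStep (f M) (f N)) {M N : Term}
    (h : PiEq M N) : PiEq (f M) (f N) :=
  Relation.ReflTransGen.lift f hf _ _ h

theorem PiEq.of_erase_eq {M N : Term} (h : M.erase = N.erase) : PiEq M N := by
  induction M generalizing N with
  | sort s => cases N <;> simp [erase] at h; subst h; exact .refl
  | var n => cases N <;> simp [erase] at h; subst h; exact .refl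
  | app A B h₁ h₂ =>
    cases N <;> simp [erase] at h
    exact ((h₁ h.1).map fun _ _ => .app_left _).trans ((h₂ h.2).map fun _ _ => .app_right _)
  | lam A B h₁ h₂ =>
    cases N <;> simp [erase] at h
    exact ((h₁ h.1).map fun _ _ => .lam_dom _).trans ((h₂ h.2).map fun _ _ => .lam_body _)
  | pi A B h₁ h₂ =>
    cases N <;> simp [erase] at h
    exact ((h₁ h.1).map fun _ _ => .pi_dom _).trans ((h₂ h.2).map fun _ _ => .pi_cod _)
  | psub A B h₁ h₂ =>
    cases N <;> simp [erase] at h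
    exact ((h₁ h.1).map fun _ _ => .psub_type _).trans ((h₂ h.2).map fun _ _ => .psub_pred _)
  | fst A B C h₁ h₂ h₃ =>
    cases N <;> simp [erase] at h
    exact (((h₁ h.1).map fun _ _ => .fst_type _ _).trans
      ((h₂ h.2.1).map fun _ _ => .fst_pred _ _)).trans ((h₃ h.2.2).map fun _ _ => .fst_arg _ _)
  | snd A B C h₁ h₂ h₃ =>
    cases N <;> simp [erase] at h
    exact (((h₁ h.1).map fun _ _ => .snd_type _ _).trans
      ((h₂ h.2.1).map fun _ _ => .snd_pred _ _)).trans ((h₃ h.2.2).map fun _ _ => .snd_arg _ _)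
  | pair A B C D h₁ h₂ h₃ _ =>
    cases N <;> simp [erase] at h
    exact ((((h₁ h.1).map fun _ _ => .pair_type _ _ _).trans
      ((h₂ h.2.1).map fun _ _ => .pair_pred _ _ _)).trans
      ((h₃ h.2.2).map fun _ _ => .pair_elem _ _ _)).tail (.root (.mk _ _ _ _ _))

/-- Reduction commutes with equality of erasures: a redex with its redex pattern is present in
all terms with the same erasure, unless it lies in an erased proof, where there is nothing to do. -/
theorem Par.lift_erase {M M' : Term} (h : Par M M') {N : Term} (he : N.erase = M.erase) :
    ∃ N', Reds N N' ∧ N'.erase = M'.erase := by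
  induction h generalizing N with
  | sort | var => exact ⟨N, .refl, he⟩
  | app _ _ h₁ h₂ =>
    cases N <;> simp [erase] at he
    obtain ⟨A, a, a'⟩ := h₁ he.1
    obtain ⟨B, b, b'⟩ := h₂ he.2
    exact ⟨_, a.app b, by simp [erase, *]⟩
  | lam _ _ h₁ h₂ =>
    cases N <;> simp [erase] at he
    obtain ⟨A, a, a'⟩ := h₁ he.1
    obtain ⟨B, b, b'⟩ := h₂ he.2
    exact ⟨_, a.lam b, by simp [erase, *]⟩
  | pi _ _ h₁ h₂ =>
    cases N <;> simp [erase] at he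
    obtain ⟨A, a, a'⟩ := h₁ he.1
    obtain ⟨B, b, b'⟩ := h₂ he.2
    exact ⟨_, a.pi b, by simp [erase, *]⟩
  | psub _ _ h₁ h₂ =>
    cases N <;> simp [erase] at he
    obtain ⟨A, a, a'⟩ := h₁ he.1
    obtain ⟨B, b, b'⟩ := h₂ he.2
    exact ⟨_, a.psub b, by simp [erase, *]⟩
  | pair _ _ _ _ h₁ h₂ h₃ _ =>
    cases N <;> simp [erase] at he
    obtain ⟨A, a, a'⟩ := h₁ he.1
    obtain ⟨B, b, b'⟩ := h₂ he.2.1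
    obtain ⟨C, c, c'⟩ := h₃ he.2.2
    exact ⟨_, a.pair b c .refl, by simp [erase, *]⟩
  | fst _ _ _ h₁ h₂ h₃ =>
    cases N <;> simp [erase] at he
    obtain ⟨A, a, a'⟩ := h₁ he.1
    obtain ⟨B, b, b'⟩ := h₂ he.2.1
    obtain ⟨C, c, c'⟩ := h₃ he.2.2
    exact ⟨_, a.fst b c, by simp [erase, *]⟩
  | snd _ _ _ h₁ h₂ h₃ =>
    cases N <;> simp [erase] at he
    obtain ⟨A, a, a'⟩ := h₁ he.1
    obtain ⟨B, b, b'⟩ := h₂ he.2.1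
    obtain ⟨C, c, c'⟩ := h₃ he.2.2
    exact ⟨_, a.snd b c, by simp [erase, *]⟩
  | beta _ _ h₁ h₂ =>
    rcases N with _ | _ | ⟨L, B⟩ <;> simp [erase] at he
    rcases L with _ | _ | _ | ⟨T, A⟩ <;> simp [erase] at he
    obtain ⟨A', a, a'⟩ := h₁ he.1.2
    obtain ⟨B', b, b'⟩ := h₂ he.2
    exact ⟨A'.inst B', ((Reds.lam .refl a).app b).tail (Or.inl (.root (.mk _ _ _))), by
      simp [erase_inst, *]⟩
  | fst_pair _ h₁ =>
    rcases N with _ | _ | _ | _ | _ | _ | _ | ⟨T, p, L⟩ <;> simp [erase] at he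
    rcases L with _ | _ | _ | _ | _ | _ | ⟨t, u, n, q⟩ <;> simp [erase] at he
    obtain ⟨A, a, a'⟩ := h₁ he.2.2.2.2
    exact ⟨A, (Reds.fst .refl .refl (.pair .refl .refl a .refl)).tail (Or.inr (.root (.mk ..))), a'⟩

theorem Reds.lift_erase {M M' : Term} (h : Reds M M') {N : Term} (he : N.erase = M.erase) :
    ∃ N', Reds N N' ∧ N'.erase = M'.erase := by
  induction h with
  | refl => exact ⟨N, .refl, he⟩
  | tail _ h ih =>
    obtain ⟨N₁, h₁, e₁⟩ := ih
    obtain ⟨N₂, h₂, e₂⟩ := (Par.of_red h).lift_erase e₁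
    exact ⟨N₂, h₁.trans h₂, e₂⟩

namespace Conv

theorem refl (M : Term) : Conv M M := Relation.EqvGen.refl M

theorem symm {M N : Term} (h : Conv M N) : Conv N M := Relation.EqvGen.symm _ _ h

theorem trans {M N P : Term} (h : Conv M N) (h' : Conv N P) : Conv M P :=
  Relation.EqvGen.trans _ _ _ h h'

theorem of_red {M N : Term} (h : Red M N) : Conv M N :=
  .rel _ _ (h.imp id .inl)

theorem of_reds {M N : Term} (h : Reds M N) : Conv M N := by
  induction h with
  | refl => exact refl _
  | tail _ h ih => exact ih.trans (of_red h)

theorem of_piStep {M N : Term} (h : PiStep M N) : Conv M N :=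
  .rel _ _ (.inr (.inr h))

theorem of_piEq {M N : Term} (h : PiEq M N) : Conv M N := by
  induction h with
  | refl => exact refl _
  | tail _ h ih => exact ih.trans (of_piStep h)

theorem of_erase_eq {M N : Term} (h : M.erase = N.erase) : Conv M N :=
  of_piEq (.of_erase_eq h)

/-- Convertible terms have reducts with the same erasure. Transitivity is where the confluence of
reduction and its commutation with erasure are used. -/
theorem exists_reds {A B : Term} (h : Conv A B) :
    ∃ A' B', Reds A A' ∧ A'.erase = B'.erase ∧ Reds B B' := by
  induction h with
  | rel A B h =>
    rcases h with h | h | h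
    · exact ⟨B, B, .single (.inl h), rfl, .refl⟩
    · exact ⟨B, B, .single (.inr h), rfl, .refl⟩
    · exact ⟨A, B, .refl, PiStep.erase_eq h, .refl⟩
  | refl A => exact ⟨A, A, .refl, rfl, .refl⟩
  | symm _ _ _ ih =>
    obtain ⟨A, B, h₁, e, h₂⟩ := ih
    exact ⟨B, A, h₂, e.symm, h₁⟩
  | trans A B C _ _ ih₁ ih₂ =>
    obtain ⟨A₁, B₁, hA, e₁, hB₁⟩ := ih₁
    obtain ⟨B₂, C₂, hB₂, e₂, hC⟩ := ih₂
    obtain ⟨D, h₁, h₂⟩ := hB₁.confluent hB₂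
    obtain ⟨A₃, h₃, e₃⟩ := h₁.lift_erase e₁
    obtain ⟨C₃, h₄, e₄⟩ := h₂.lift_erase e₂.symm
    exact ⟨A₃, C₃, hA.trans h₃, e₃.trans e₄.symm, hC.trans h₄⟩

theorem map {f : Term → Term}
    (hf : ∀ R M N, CtxClosure R M N → CtxClosure R (f M) (f N)) {M N : Term} (h : Conv M N) :
    Conv (f M) (f N) := by
  induction h with
  | rel A B h => exact .rel _ _ (h.imp (hf _ _ _) (Or.imp (hf _ _ _) (hf _ _ _)))
  | refl => exact refl _
  | symm _ _ _ ih => exact ih.symm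
  | trans _ _ _ _ _ h₁ h₂ => exact h₁.trans h₂

theorem app {M M' N N' : Term} (h₁ : Conv M M') (h₂ : Conv N N') :
    Conv (app M N) (app M' N') :=
  (h₁.map fun _ _ _ => .app_left N).trans (h₂.map fun _ _ _ => .app_right M')

theorem lam {T T' M M' : Term} (h₁ : Conv T T') (h₂ : Conv M M') :
    Conv (lam T M) (lam T' M') :=
  (h₁.map fun _ _ _ => .lam_dom M).trans (h₂.map fun _ _ _ => .lam_body T')

theorem pi {T T' U U' : Term} (h₁ : Conv T T') (h₂ : Conv U U') :
    Conv (pi T U) (pi T' U') :=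
  (h₁.map fun _ _ _ => .pi_dom U).trans (h₂.map fun _ _ _ => .pi_cod T')

theorem psub {T T' p p' : Term} (h₁ : Conv T T') (h₂ : Conv p p') :
    Conv (psub T p) (psub T' p') :=
  (h₁.map fun _ _ _ => .psub_type p).trans (h₂.map fun _ _ _ => .psub_pred T')

theorem pair {T T' p p' m m' h h' : Term} (h₁ : Conv T T') (h₂ : Conv p p')
    (h₃ : Conv m m') (h₄ : Conv h h') : Conv (pair T p m h) (pair T' p' m' h') :=
  (((h₁.map fun _ _ _ => .pair_type p m h).trans (h₂.map fun _ _ _ => .pair_pred T' m h)).trans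
    (h₃.map fun _ _ _ => .pair_elem T' p' h)).trans (h₄.map fun _ _ _ => .pair_proof T' p' m')

theorem fst {T T' p p' m m' : Term} (h₁ : Conv T T') (h₂ : Conv p p') (h₃ : Conv m m') :
    Conv (fst T p m) (fst T' p' m') :=
  ((h₁.map fun _ _ _ => .fst_type p m).trans (h₂.map fun _ _ _ => .fst_pred T' m)).trans
    (h₃.map fun _ _ _ => .fst_arg T' p')

theorem snd {T T' p p' m m' : Term} (h₁ : Conv T T') (h₂ : Conv p p') (h₃ : Conv m m') :
    Conv (snd T p m) (snd T' p' m') :=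
  ((h₁.map fun _ _ _ => .snd_type p m).trans (h₂.map fun _ _ _ => .snd_pred T' m)).trans
    (h₃.map fun _ _ _ => .snd_arg T' p')

theorem subst {M N : Term} (h : Conv M N) (σ : ℕ → Term) : Conv (M.subst σ) (N.subst σ) := by
  induction h with
  | rel A B h =>
    refine .rel _ _ (h.imp (fun h => h.subst ?_ σ) (Or.imp (fun h => h.subst ?_ σ)
      fun h => h.subst ?_ σ))
    · rintro _ _ σ ⟨T, M, N⟩
      rw [inst_subst]
      exact .mk _ _ _
    · rintro _ _ σ ⟨t₀, u₀, t₁, u₁, m, h⟩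
      exact .mk ..
    · rintro _ _ σ ⟨t, u, m, h₀, h₁⟩
      exact .mk ..
  | refl => exact refl _
  | symm _ _ _ ih => exact ih.symm
  | trans _ _ _ _ _ h₁ h₂ => exact h₁.trans h₂

theorem rename {M N : Term} (h : Conv M N) (ρ : ℕ → ℕ) : Conv (M.rename ρ) (N.rename ρ) := by
  simpa only [rename_eq_subst] using h.subst _

theorem upSubst {σ τ : ℕ → Term} (h : ∀ n, Conv (σ n) (τ n)) (n : ℕ) :
    Conv (upSubst σ n) (upSubst τ n) := by
  cases n
  · exact refl _
  · exact (h _).rename _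

theorem subst_congr (M : Term) {σ τ : ℕ → Term} (h : ∀ n, Conv (σ n) (τ n)) :
    Conv (M.subst σ) (M.subst τ) := by
  induction M generalizing σ τ with
  | sort s => exact refl _
  | var n => exact h n
  | app _ _ h₁ h₂ => exact (h₁ h).app (h₂ h)
  | lam _ _ h₁ h₂ => exact (h₁ h).lam (h₂ (upSubst h))
  | pi _ _ h₁ h₂ => exact (h₁ h).pi (h₂ (upSubst h))
  | psub _ _ h₁ h₂ => exact (h₁ h).psub (h₂ h)
  | pair _ _ _ _ h₁ h₂ h₃ h₄ => exact (h₁ h).pair (h₂ h) (h₃ h) (h₄ h)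
  | fst _ _ _ h₁ h₂ h₃ => exact (h₁ h).fst (h₂ h) (h₃ h)
  | snd _ _ _ h₁ h₂ h₃ => exact (h₁ h).snd (h₂ h) (h₃ h)

theorem inst {U U' N N' : Term} (hU : Conv U U') (hN : Conv N N') :
    Conv (U.inst N) (U'.inst N') :=
  (hU.subst _).trans <| subst_congr U' fun n => by
    cases n
    · exact hN
    · exact refl _

end Conv

theorem Reds.pi_inv {T U X : Term} (h : Reds (.pi T U) X) :
    ∃ T' U', X = .pi T' U' ∧ Reds T T' ∧ Reds U U' := by
  induction h with
  | refl => exact ⟨T, U, rfl, .refl, .refl⟩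
  | tail _ h ih =>
    obtain ⟨T', U', rfl, h₁, h₂⟩ := ih
    cases Par.of_red h with
    | pi a b => exact ⟨_, _, rfl, h₁.trans a.reds, h₂.trans b.reds⟩

theorem Reds.psub_inv {T p X : Term} (h : Reds (.psub T p) X) :
    ∃ T' p', X = .psub T' p' ∧ Reds T T' ∧ Reds p p' := by
  induction h with
  | refl => exact ⟨T, p, rfl, .refl, .refl⟩
  | tail _ h ih =>
    obtain ⟨T', U', rfl, h₁, h₂⟩ := ih
    cases Par.of_red h with
    | psub a b => exact ⟨_, _, rfl, h₁.trans a.reds, h₂.trans b.reds⟩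

theorem Conv.pi_inj {T T' U U' : Term} (h : Conv (.pi T U) (.pi T' U')) :
    Conv T T' ∧ Conv U U' := by
  obtain ⟨A, B, hA, e, hB⟩ := h.exists_reds
  obtain ⟨T₁, U₁, rfl, h₁, h₂⟩ := hA.pi_inv
  obtain ⟨T₂, U₂, rfl, h₃, h₄⟩ := hB.pi_inv
  simp only [erase, Term.pi.injEq] at e
  exact ⟨((of_reds h₁).trans (of_erase_eq e.1)).trans (of_reds h₃).symm,
    ((of_reds h₂).trans (of_erase_eq e.2)).trans (of_reds h₄).symm⟩

theorem Conv.psub_inj {T T' p p' : Term} (h : Conv (.psub T p) (.psub T' p')) :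
    Conv T T' ∧ Conv p p' := by
  obtain ⟨A, B, hA, e, hB⟩ := h.exists_reds
  obtain ⟨T₁, U₁, rfl, h₁, h₂⟩ := hA.psub_inv
  obtain ⟨T₂, U₂, rfl, h₃, h₄⟩ := hB.psub_inv
  simp only [erase, Term.psub.injEq] at e
  exact ⟨((of_reds h₁).trans (of_erase_eq e.1)).trans (of_reds h₃).symm,
    ((of_reds h₂).trans (of_erase_eq e.2)).trans (of_reds h₄).symm⟩

/-! ### Renaming and substitution in typing derivations -/

theorem wf_sigPsub : WF sigPsub := by
  have h₁ : WF [sort Srt.type] := .decl (.sort .empty .type_kind)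
  have h₂ : HasType [sort Srt.type] (.var 0) (.sort Srt.type) := .var h₁ (.zero _ _)
  exact .decl (.prod .type_type h₂ (.sort (.decl h₂) .prop_type))

namespace HasType

/-! The rules for the symbols, without the premises that type their declarations. -/

theorem mk_psub {Γ : Ctx} {T p : Term} (hT : HasType Γ T (.sort .type))
    (hp : HasType Γ p (.pi T (.sort .prop))) : HasType Γ (.psub T p) (.sort .type) :=
  .psub (.sort wf_sigPsub .type_kind) hT hp

theorem sigPsub_type : HasType sigPsub (.var 1) (.sort .type) :=
  .var wf_sigPsub (.succ _ (.zero _ _))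

theorem sigPsub_pred : HasType sigPsub (.var 0) (.pi (.var 1) (.sort .prop)) :=
  .var wf_sigPsub (.zero _ _)

theorem wf_sigProj : WF sigProj :=
  .decl (mk_psub sigPsub_type sigPsub_pred)

theorem mk_fst {Γ : Ctx} {T p m : Term} (hT : HasType Γ T (.sort .type))
    (hp : HasType Γ p (.pi T (.sort .prop))) (hm : HasType Γ m (.psub T p)) :
    HasType Γ (.fst T p m) T :=
  .fst (.var wf_sigProj (.succ _ (.succ _ (.zero _ _)))) hT hp hm

theorem mk_snd {Γ : Ctx} {T p m : Term} (hT : HasType Γ T (.sort .type))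
    (hp : HasType Γ p (.pi T (.sort .prop))) (hm : HasType Γ m (.psub T p)) :
    HasType Γ (.snd T p m) (.app p (.fst T p m)) := by
  have h₁ : HasType sigProj (.var 2) (.sort .type) :=
    .var wf_sigProj (.succ _ (.succ _ (.zero _ _)))
  have h₂ : HasType sigProj (.var 1) (.pi (.var 2) (.sort .prop)) :=
    .var wf_sigProj (.succ _ (.zero _ _))
  have h₃ : HasType sigProj (.var 0) (.psub (.var 2) (.var 1)) := .var wf_sigProj (.zero _ _)
  exact .snd (.app (U := .sort .prop) h₂ (mk_fst h₁ h₂ h₃)) hT hp hm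

theorem mk_pair {Γ : Ctx} {T p m h : Term} (hT : HasType Γ T (.sort .type))
    (hp : HasType Γ p (.pi T (.sort .prop))) (hm : HasType Γ m T) (hh : HasType Γ h (.app p m)) :
    HasType Γ (.pair T p m h) (.psub T p) := by
  have w₁ : WF (.var 1 :: sigPsub) := .decl sigPsub_type
  have w₂ : WF sigPair := .decl (.app (U := .sort .prop) (T := .var 2)
    (.var w₁ (.succ _ (.zero _ _))) (.var w₁ (.zero _ _)))
  exact .pair (mk_psub (.var w₂ (.succ _ (.succ _ (.succ _ (.zero _ _)))))
    (.var w₂ (.succ _ (.succ _ (.zero _ _))))) hT hp hm hh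

end HasType

/-- Induction on typing derivations, with no induction hypothesis for the well-formedness of
contexts nor for the closed premises that type the declarations of the signature. In the case of an
abstraction, the typing of the product is replaced by the premises of its formation rule. -/
@[elab_as_elim]
theorem HasType.ind {motive : (Γ : Ctx) → (M T : Term) → HasType Γ M T → Prop}
    (var : ∀ {Γ n T} (w : WF Γ) (hl : Lookup Γ n T), motive Γ (.var n) T (.var w hl))
    (conv : ∀ {Γ M T U s} (h₁ : HasType Γ M U) (h₂ : HasType Γ T (.sort s)) (c : Conv T U),
      motive _ _ _ h₁ → motive _ _ _ h₂ → motive Γ M T (.conv h₁ h₂ c))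
    (sort : ∀ {Γ s₁ s₂} (w : WF Γ) (a : Srt.Ax s₁ s₂),
      motive Γ (.sort s₁) (.sort s₂) (.sort w a))
    (prod : ∀ {Γ T U s₁ s₂ s₃} (r : Srt.Rule s₁ s₂ s₃) (h₁ : HasType Γ T (.sort s₁))
      (h₂ : HasType (T :: Γ) U (.sort s₂)), motive _ _ _ h₁ → motive _ _ _ h₂ →
      motive Γ (.pi T U) (.sort s₃) (.prod r h₁ h₂))
    (abst : ∀ {Γ T U M s₁ s₂ s₃} (r : Srt.Rule s₁ s₂ s₃) (h₁ : HasType Γ T (.sort s₁))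
      (h₂ : HasType (T :: Γ) U (.sort s₂)) (h₃ : HasType (T :: Γ) M U), motive _ _ _ h₁ →
      motive _ _ _ h₂ → motive _ _ _ h₃ →
      motive Γ (.lam T M) (.pi T U) (.abst (.prod r h₁ h₂) h₃))
    (app : ∀ {Γ M N T U} (h₁ : HasType Γ M (.pi T U)) (h₂ : HasType Γ N T),
      motive _ _ _ h₁ → motive _ _ _ h₂ → motive Γ (.app M N) (U.inst N) (.app h₁ h₂))
    (psub : ∀ {Γ T p} (h₁ : HasType Γ T (.sort .type))
      (h₂ : HasType Γ p (.pi T (.sort .prop))), motive _ _ _ h₁ → motive _ _ _ h₂ →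
      motive Γ (.psub T p) (.sort .type) (mk_psub h₁ h₂))
    (pair : ∀ {Γ T p m h} (h₁ : HasType Γ T (.sort .type))
      (h₂ : HasType Γ p (.pi T (.sort .prop))) (h₃ : HasType Γ m T)
      (h₄ : HasType Γ h (.app p m)), motive _ _ _ h₁ → motive _ _ _ h₂ → motive _ _ _ h₃ →
      motive _ _ _ h₄ → motive Γ (.pair T p m h) (.psub T p) (mk_pair h₁ h₂ h₃ h₄))
    (fst : ∀ {Γ T p m} (h₁ : HasType Γ T (.sort .type))
      (h₂ : HasType Γ p (.pi T (.sort .prop))) (h₃ : HasType Γ m (.psub T p)),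
      motive _ _ _ h₁ → motive _ _ _ h₂ → motive _ _ _ h₃ →
      motive Γ (.fst T p m) T (mk_fst h₁ h₂ h₃))
    (snd : ∀ {Γ T p m} (h₁ : HasType Γ T (.sort .type))
      (h₂ : HasType Γ p (.pi T (.sort .prop))) (h₃ : HasType Γ m (.psub T p)),
      motive _ _ _ h₁ → motive _ _ _ h₂ → motive _ _ _ h₃ →
      motive Γ (.snd T p m) (.app p (.fst T p m)) (mk_snd h₁ h₂ h₃))
    {Γ : Ctx} {M T : Term} (h : HasType Γ M T) : motive Γ M T h := by
  refine (HasType.rec (motive_1 := fun _ _ => True) (motive_2 := fun Γ M T h => motive Γ M T h ∧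
    ∀ A B, M = .pi A B → ∃ s₁ s₂ s₃, ∃ (_ : Srt.Rule s₁ s₂ s₃) (h₁ : HasType Γ A (.sort s₁))
      (h₂ : HasType (A :: Γ) B (.sort s₂)), motive _ _ _ h₁ ∧ motive _ _ _ h₂)
    trivial (fun _ _ => trivial) ?_ ?_ ?_ ?_ ?_ ?_ ?_ ?_ ?_ ?_ h).1
  · exact fun w hl _ => ⟨var w hl, nofun⟩
  · exact fun h₁ h₂ c i₁ i₂ => ⟨conv h₁ h₂ c i₁.1 i₂.1, i₁.2⟩
  · exact fun w a _ => ⟨sort w a, nofun⟩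
  · refine fun r h₁ h₂ i₁ i₂ => ⟨prod r h₁ h₂ i₁.1 i₂.1, ?_⟩
    rintro _ _ ⟨⟩
    exact ⟨_, _, _, r, h₁, h₂, i₁.1, i₂.1⟩
  · intro _ _ _ _ _ _ h₃ i₁ i₂
    obtain ⟨_, _, _, r, h₁, h₂, j₁, j₂⟩ := i₁.2 _ _ rfl
    exact ⟨abst r h₁ h₂ h₃ j₁ j₂ i₂.1, nofun⟩
  · exact fun h₁ h₂ i₁ i₂ => ⟨app h₁ h₂ i₁.1 i₂.1, nofun⟩
  · exact fun _ h₁ h₂ _ i₁ i₂ => ⟨psub h₁ h₂ i₁.1 i₂.1, nofun⟩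
  · exact fun _ h₁ h₂ h₃ h₄ _ i₁ i₂ i₃ i₄ => ⟨pair h₁ h₂ h₃ h₄ i₁.1 i₂.1 i₃.1 i₄.1, nofun⟩
  · exact fun _ h₁ h₂ h₃ _ i₁ i₂ i₃ => ⟨fst h₁ h₂ h₃ i₁.1 i₂.1 i₃.1, nofun⟩
  · exact fun _ h₁ h₂ h₃ _ i₁ i₂ i₃ => ⟨snd h₁ h₂ h₃ i₁.1 i₂.1 i₃.1, nofun⟩

theorem HasType.wf {Γ : Ctx} {M T : Term} (h : HasType Γ M T) : WF Γ := by
  induction h using HasType.ind <;> assumption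

theorem WF.exists_sort {Γ : Ctx} {T : Term} (h : WF (T :: Γ)) : ∃ s, HasType Γ T (.sort s) := by
  cases h; exact ⟨_, ‹_›⟩

theorem Lookup.upRen {Γ Δ : Ctx} {ρ : ℕ → ℕ}
    (h : ∀ n A, Lookup Γ n A → Lookup Δ (ρ n) (A.rename ρ)) (T : Term) (n : ℕ) (A : Term)
    (hn : Lookup (T :: Γ) n A) : Lookup (T.rename ρ :: Δ) (upRen ρ n) (A.rename (upRen ρ)) := by
  cases hn with
  | zero => rw [← lift_rename]; exact .zero _ _
  | succ _ hn => rw [← lift_rename]; exact .succ _ (h _ _ hn)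

/-- Inversion of the typing of a product. -/
theorem HasType.pi_inv {Γ : Ctx} {T U X : Term} (h : HasType Γ (.pi T U) X) :
    ∃ s₁ s₂ s₃, Srt.Rule s₁ s₂ s₃ ∧ HasType Γ T (.sort s₁) ∧ HasType (T :: Γ) U (.sort s₂) := by
  generalize hM : Term.pi T U = M at h
  induction h using HasType.ind with
  | conv _ _ _ ih => exact ih hM
  | prod r h₁ h₂ => cases hM; exact ⟨_, _, _, r, h₁, h₂⟩
  | _ => cases hM

theorem HasType.rename {Γ : Ctx} {M T : Term} (h : HasType Γ M T) {Δ : Ctx} {ρ : ℕ → ℕ}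
    (hΔ : WF Δ) (hρ : ∀ n A, Lookup Γ n A → Lookup Δ (ρ n) (A.rename ρ)) :
    HasType Δ (M.rename ρ) (T.rename ρ) := by
  induction h using HasType.ind generalizing Δ ρ with
  | var _ hl => exact .var hΔ (hρ _ _ hl)
  | conv _ _ c i₁ i₂ => exact .conv (i₁ hΔ hρ) (i₂ hΔ hρ) (c.rename _)
  | sort _ a => exact .sort hΔ a
  | prod r _ _ i₁ i₂ =>
    exact .prod r (i₁ hΔ hρ) (i₂ (.decl (i₁ hΔ hρ)) (Lookup.upRen hρ _))
  | abst r _ _ _ i₁ i₂ i₃ =>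
    have w : WF _ := .decl (i₁ hΔ hρ)
    exact .abst (.prod r (i₁ hΔ hρ) (i₂ w (Lookup.upRen hρ _))) (i₃ w (Lookup.upRen hρ _))
  | app _ _ i₁ i₂ => rw [inst_rename]; exact .app (i₁ hΔ hρ) (i₂ hΔ hρ)
  | psub _ _ i₁ i₂ => exact mk_psub (i₁ hΔ hρ) (i₂ hΔ hρ)
  | pair _ _ _ _ i₁ i₂ i₃ i₄ => exact mk_pair (i₁ hΔ hρ) (i₂ hΔ hρ) (i₃ hΔ hρ) (i₄ hΔ hρ)
  | fst _ _ _ i₁ i₂ i₃ => exact mk_fst (i₁ hΔ hρ) (i₂ hΔ hρ) (i₃ hΔ hρ)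
  | snd _ _ _ i₁ i₂ i₃ => exact mk_snd (i₁ hΔ hρ) (i₂ hΔ hρ) (i₃ hΔ hρ)

theorem HasType.weaken {Γ : Ctx} {M T U : Term} (h : HasType Γ M T) (hU : WF (U :: Γ)) :
    HasType (U :: Γ) M.lift T.lift :=
  h.rename hU fun _ _ hl => .succ _ hl

/-- The substitution `σ` maps the variables of `Γ` to terms of the corresponding types in `Δ`. -/
def SubstTyped (Γ Δ : Ctx) (σ : ℕ → Term) : Prop :=
  ∀ n A, Lookup Γ n A → HasType Δ (σ n) (A.subst σ)

theorem SubstTyped.up {Γ Δ : Ctx} {σ : ℕ → Term} (h : SubstTyped Γ Δ σ) {T : Term}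
    (hT : WF (T.subst σ :: Δ)) : SubstTyped (T :: Γ) (T.subst σ :: Δ) (upSubst σ) := by
  intro n A hn
  cases hn with
  | zero => rw [← lift_subst]; exact .var hT (.zero _ _)
  | succ _ hn => rw [← lift_subst]; exact (h _ _ hn).weaken hT

theorem HasType.subst {Γ : Ctx} {M T : Term} (h : HasType Γ M T) {Δ : Ctx} {σ : ℕ → Term}
    (hΔ : WF Δ) (hσ : SubstTyped Γ Δ σ) : HasType Δ (M.subst σ) (T.subst σ) := by
  induction h using HasType.ind generalizing Δ σ with
  | var _ hl => exact hσ _ _ hl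
  | conv _ _ c i₁ i₂ => exact .conv (i₁ hΔ hσ) (i₂ hΔ hσ) (c.subst _)
  | sort _ a => exact .sort hΔ a
  | prod r _ _ i₁ i₂ =>
    have w : WF _ := .decl (i₁ hΔ hσ)
    exact .prod r (i₁ hΔ hσ) (i₂ w (hσ.up w))
  | abst r _ _ _ i₁ i₂ i₃ =>
    have w : WF _ := .decl (i₁ hΔ hσ)
    exact .abst (.prod r (i₁ hΔ hσ) (i₂ w (hσ.up w))) (i₃ w (hσ.up w))
  | app _ _ i₁ i₂ => rw [inst_subst]; exact .app (i₁ hΔ hσ) (i₂ hΔ hσ)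
  | psub _ _ i₁ i₂ => exact mk_psub (i₁ hΔ hσ) (i₂ hΔ hσ)
  | pair _ _ _ _ i₁ i₂ i₃ i₄ => exact mk_pair (i₁ hΔ hσ) (i₂ hΔ hσ) (i₃ hΔ hσ) (i₄ hΔ hσ)
  | fst _ _ _ i₁ i₂ i₃ => exact mk_fst (i₁ hΔ hσ) (i₂ hΔ hσ) (i₃ hΔ hσ)
  | snd _ _ _ i₁ i₂ i₃ => exact mk_snd (i₁ hΔ hσ) (i₂ hΔ hσ) (i₃ hΔ hσ)

theorem HasType.inst {Γ : Ctx} {M N T U : Term} (h : HasType (T :: Γ) M U)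
    (hN : HasType Γ N T) : HasType Γ (M.inst N) (U.inst N) := by
  refine h.subst hN.wf fun n A hn => ?_
  cases hn with
  | zero => rw [lift_subst_single]; exact hN
  | succ _ hn => rw [lift_subst_single]; exact .var hN.wf hn

/-- The last declaration of a context may be replaced by a convertible one. -/
theorem HasType.conv_ctx {Γ : Ctx} {T T' M U : Term} {s : Srt} (h : HasType (T :: Γ) M U)
    (hT' : HasType Γ T' (.sort s)) (c : Conv T T') : HasType (T' :: Γ) M U := by
  obtain ⟨s₀, hT⟩ := h.wf.exists_sort
  have w : WF (T' :: Γ) := .decl hT'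
  rw [← subst_var M, ← subst_var U]
  refine h.subst w fun n A hn => ?_
  rw [subst_var]
  cases hn with
  | zero => exact .conv (.var w (.zero _ _)) (hT.weaken w) (c.rename _)
  | succ _ hn => exact .var w (.succ _ hn)

theorem Lookup.exists_sort {Γ : Ctx} {n : ℕ} {T : Term} (h : Lookup Γ n T) (hΓ : WF Γ) :
    ∃ s, HasType Γ T (.sort s) := by
  induction h with
  | zero Γ T =>
    obtain ⟨s, h⟩ := hΓ.exists_sort
    exact ⟨s, h.weaken hΓ⟩
  | succ U _ ih =>
    obtain ⟨_, h⟩ := hΓ.exists_sort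
    obtain ⟨s, h⟩ := ih h.wf
    exact ⟨s, h.weaken hΓ⟩

/-! ### Inversion and validity of types -/

namespace HasType

variable {Γ : Ctx}

theorem lam_inv {T M X : Term} (h : HasType Γ (.lam T M) X) :
    ∃ U s, HasType Γ (.pi T U) (.sort s) ∧ HasType (T :: Γ) M U ∧ Conv X (.pi T U) := by
  generalize hM : Term.lam T M = L at h
  induction h using HasType.ind with
  | conv _ _ c ih =>
    obtain ⟨U, s, h₁, h₂, c'⟩ := ih hM
    exact ⟨U, s, h₁, h₂, c.trans c'⟩
  | abst r h₁ h₂ h₃ => cases hM; exact ⟨_, _, .prod r h₁ h₂, h₃, .refl _⟩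
  | _ => cases hM

theorem app_inv {M N X : Term} (h : HasType Γ (.app M N) X) :
    ∃ T U, HasType Γ M (.pi T U) ∧ HasType Γ N T := by
  generalize hM : Term.app M N = L at h
  induction h using HasType.ind with
  | conv _ _ _ ih => exact ih hM
  | app h₁ h₂ => cases hM; exact ⟨_, _, h₁, h₂⟩
  | _ => cases hM

theorem psub_inv {T p X : Term} (h : HasType Γ (.psub T p) X) :
    HasType Γ T (.sort .type) ∧ HasType Γ p (.pi T (.sort .prop)) := by
  generalize hM : Term.psub T p = L at h
  induction h using HasType.ind with
  | conv _ _ _ ih => exact ih hM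
  | psub h₁ h₂ => cases hM; exact ⟨h₁, h₂⟩
  | _ => cases hM

theorem pair_inv {T p m q X : Term} (h : HasType Γ (.pair T p m q) X) :
    HasType Γ T (.sort .type) ∧ HasType Γ p (.pi T (.sort .prop)) ∧ HasType Γ m T ∧
      HasType Γ q (.app p m) ∧ Conv X (.psub T p) := by
  generalize hM : Term.pair T p m q = L at h
  induction h using HasType.ind with
  | conv _ _ c ih =>
    obtain ⟨h₁, h₂, h₃, h₄, c'⟩ := ih hM
    exact ⟨h₁, h₂, h₃, h₄, c.trans c'⟩
  | pair h₁ h₂ h₃ h₄ => cases hM; exact ⟨h₁, h₂, h₃, h₄, .refl _⟩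
  | _ => cases hM

theorem fst_inv {T p m X : Term} (h : HasType Γ (.fst T p m) X) :
    HasType Γ T (.sort .type) ∧ HasType Γ p (.pi T (.sort .prop)) ∧ HasType Γ m (.psub T p) := by
  generalize hM : Term.fst T p m = L at h
  induction h using HasType.ind with
  | conv _ _ _ ih => exact ih hM
  | fst h₁ h₂ h₃ => cases hM; exact ⟨h₁, h₂, h₃⟩
  | _ => cases hM

theorem snd_inv {T p m X : Term} (h : HasType Γ (.snd T p m) X) :
    HasType Γ T (.sort .type) ∧ HasType Γ p (.pi T (.sort .prop)) ∧ HasType Γ m (.psub T p) := by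
  generalize hM : Term.snd T p m = L at h
  induction h using HasType.ind with
  | conv _ _ _ ih => exact ih hM
  | snd h₁ h₂ h₃ => cases hM; exact ⟨h₁, h₂, h₃⟩
  | _ => cases hM

/-- A predicate on `T`, applied to an element of `T`, is a proposition. -/
theorem app_pred {T p m : Term} (hp : HasType Γ p (.pi T (.sort .prop))) (hm : HasType Γ m T) :
    HasType Γ (.app p m) (.sort .prop) :=
  .app (U := .sort .prop) hp hm

theorem pi_prop {T : Term} (hT : HasType Γ T (.sort .type)) :
    HasType Γ (.pi T (.sort .prop)) (.sort .type) :=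
  .prod .type_type hT (.sort (.decl hT) .prop_type)

/-- Validity of types: the type of a term is `Kind`, which has no type, or has a sort as type. -/
theorem eq_kind_or_exists_sort {M T : Term} (h : HasType Γ M T) :
    T = .sort .kind ∨ ∃ s, HasType Γ T (.sort s) := by
  induction h using HasType.ind with
  | var w hl => exact .inr (hl.exists_sort w)
  | conv _ h => exact .inr ⟨_, h⟩
  | sort w a =>
    cases a
    · exact .inr ⟨_, .sort w .type_kind⟩
    · exact .inl rfl
  | prod r h =>
    cases r
    · exact .inr ⟨_, .sort h.wf .prop_type⟩
    · exact .inr ⟨_, .sort h.wf .type_kind⟩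
    · exact .inr ⟨_, .sort h.wf .prop_type⟩
  | abst r h₁ h₂ => exact .inr ⟨_, .prod r h₁ h₂⟩
  | app _ hN ih =>
    obtain h | ⟨s, h⟩ := ih
    · cases h
    · obtain ⟨_, s₂, _, _, _, hU⟩ := h.pi_inv
      exact .inr ⟨s₂, hU.inst hN⟩
  | psub h => exact .inr ⟨_, .sort h.wf .type_kind⟩
  | pair h₁ h₂ => exact .inr ⟨_, mk_psub h₁ h₂⟩
  | fst h => exact .inr ⟨_, h⟩
  | snd h₁ h₂ h₃ => exact .inr ⟨_, app_pred h₂ (mk_fst h₁ h₂ h₃)⟩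

theorem exists_sort_of_pi {M T U : Term} (h : HasType Γ M (.pi T U)) :
    ∃ s, HasType Γ (.pi T U) (.sort s) :=
  h.eq_kind_or_exists_sort.resolve_left fun h => by cases h

/-! ### Typed congruence

A subterm may be replaced by a convertible one of the same type, without a change of the type of
the whole term. -/

theorem pi_congr {T T' U' : Term} {s₁ s₂ s₃ : Srt} (r : Srt.Rule s₁ s₂ s₃)
    (hT' : HasType Γ T' (.sort s₁)) (cT : Conv T T') (hU' : HasType (T :: Γ) U' (.sort s₂)) :
    HasType Γ (.pi T' U') (.sort s₃) :=
  .prod r hT' (hU'.conv_ctx hT' cT)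

theorem lam_congr {T T' U M' : Term} {s₁ s₂ s₃ : Srt} (r : Srt.Rule s₁ s₂ s₃)
    (hT : HasType Γ T (.sort s₁)) (hU : HasType (T :: Γ) U (.sort s₂))
    (hT' : HasType Γ T' (.sort s₁)) (cT : Conv T T') (hM' : HasType (T :: Γ) M' U) :
    HasType Γ (.lam T' M') (.pi T U) :=
  .conv (.abst (pi_congr r hT' cT hU) (hM'.conv_ctx hT' cT)) (.prod r hT hU) (cT.pi (.refl U))

theorem app_congr {M' N N' T U : Term} (hM' : HasType Γ M' (.pi T U)) (hN : HasType Γ N T)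
    (hN' : HasType Γ N' T) (cN : Conv N N') : HasType Γ (.app M' N') (U.inst N) := by
  obtain ⟨s, hP⟩ := hM'.exists_sort_of_pi
  obtain ⟨_, s₂, _, _, _, hU⟩ := hP.pi_inv
  exact .conv (.app hM' hN') (hU.inst hN) (.inst (.refl U) cN)

theorem pred_conv {T T' p : Term} (hp : HasType Γ p (.pi T (.sort .prop)))
    (hT' : HasType Γ T' (.sort .type)) (cT : Conv T T') : HasType Γ p (.pi T' (.sort .prop)) :=
  .conv hp (pi_prop hT') (cT.symm.pi (.refl _))

theorem psub_congr {T T' p' : Term} (hT' : HasType Γ T' (.sort .type)) (cT : Conv T T')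
    (hp' : HasType Γ p' (.pi T (.sort .prop))) : HasType Γ (.psub T' p') (.sort .type) :=
  mk_psub hT' (hp'.pred_conv hT' cT)

theorem pair_congr {T T' p p' m m' h' : Term} (hT : HasType Γ T (.sort .type))
    (hp : HasType Γ p (.pi T (.sort .prop))) (hT' : HasType Γ T' (.sort .type)) (cT : Conv T T')
    (hp' : HasType Γ p' (.pi T (.sort .prop))) (cp : Conv p p') (hm' : HasType Γ m' T)
    (cm : Conv m m') (hh' : HasType Γ h' (.app p m)) :
    HasType Γ (.pair T' p' m' h') (.psub T p) :=
  .conv (mk_pair hT' (hp'.pred_conv hT' cT) (hm'.conv hT' cT.symm)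
    (hh'.conv (app_pred hp' hm') (cp.symm.app cm.symm))) (mk_psub hT hp) (cT.psub cp)

theorem fst_congr {T T' p p' m' : Term} (hT : HasType Γ T (.sort .type))
    (hT' : HasType Γ T' (.sort .type)) (cT : Conv T T')
    (hp' : HasType Γ p' (.pi T (.sort .prop))) (cp : Conv p p') (hm' : HasType Γ m' (.psub T p)) :
    HasType Γ (.fst T' p' m') T :=
  have hp₂ := hp'.pred_conv hT' cT
  .conv (mk_fst hT' hp₂ (hm'.conv (mk_psub hT' hp₂) (cT.psub cp).symm)) hT cT

theorem snd_congr {T T' p p' m m' : Term} (hT : HasType Γ T (.sort .type))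
    (hp : HasType Γ p (.pi T (.sort .prop))) (hm : HasType Γ m (.psub T p))
    (hT' : HasType Γ T' (.sort .type)) (cT : Conv T T')
    (hp' : HasType Γ p' (.pi T (.sort .prop))) (cp : Conv p p') (hm' : HasType Γ m' (.psub T p))
    (cm : Conv m m') : HasType Γ (.snd T' p' m') (.app p (.fst T p m)) :=
  have hp₂ := hp'.pred_conv hT' cT
  .conv (mk_snd hT' hp₂ (hm'.conv (mk_psub hT' hp₂) (cT.psub cp).symm))
    (app_pred hp (mk_fst hT hp hm)) (cp.app (cT.fst cp cm))

end HasType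

/-! ### Subject reduction -/

/-- Subject reduction. -/
theorem HasType.red {Γ : Ctx} {M M' T : Term} (h : HasType Γ M T) (hr : CtxClosure RedRoot M M') :
    HasType Γ M' T := by
  have conv {A B : Term} (h : CtxClosure RedRoot A B) : Conv A B := .of_red (red_iff.2 h)
  induction h using HasType.ind generalizing M' with
  | var | sort =>
    cases hr with
    | root hr => obtain hr | hr := hr <;> cases hr
  | conv _ h₂ c i₁ => exact .conv (i₁ hr) h₂ c
  | prod r h₁ h₂ i₁ i₂ =>
    cases hr with
    | root hr => obtain hr | hr := hr <;> cases hr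
    | pi_dom _ hr => exact pi_congr r (i₁ hr) (conv hr) h₂
    | pi_cod _ hr => exact .prod r h₁ (i₂ hr)
  | abst r h₁ h₂ h₃ i₁ _ i₃ =>
    cases hr with
    | root hr => obtain hr | hr := hr <;> cases hr
    | lam_dom _ hr => exact lam_congr r h₁ h₂ (i₁ hr) (conv hr) h₃
    | lam_body _ hr => exact .abst (.prod r h₁ h₂) (i₃ hr)
  | app h₁ h₂ i₁ i₂ =>
    cases hr with
    | root hr =>
      obtain ⟨T, M, N⟩ | hr := hr
      swap
      · cases hr
      -- the body is typed for the domain of the abstraction, the argument for that of the product;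
      -- injectivity of `pi` identifies them
      obtain ⟨U', s, hP, hM, c⟩ := h₁.lam_inv
      obtain ⟨c₁, c₂⟩ := c.pi_inj
      obtain ⟨s₁, _, _, _, hT, _⟩ := hP.pi_inv
      obtain ⟨_, hP'⟩ := h₁.exists_sort_of_pi
      obtain ⟨_, s₂, _, _, _, hU⟩ := hP'.pi_inv
      exact .conv (hM.inst (h₂.conv hT c₁.symm)) (hU.inst h₂) (c₂.inst (.refl _))
    | app_left _ hr => exact .app (i₁ hr) h₂
    | app_right _ hr => exact app_congr h₁ h₂ (i₂ hr) (conv hr)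
  | psub h₁ h₂ i₁ i₂ =>
    cases hr with
    | root hr => obtain hr | hr := hr <;> cases hr
    | psub_type _ hr => exact psub_congr (i₁ hr) (conv hr) h₂
    | psub_pred _ hr => exact mk_psub h₁ (i₂ hr)
  | pair h₁ h₂ h₃ h₄ i₁ i₂ i₃ i₄ =>
    cases hr with
    | root hr => obtain hr | hr := hr <;> cases hr
    | pair_type _ _ _ hr => exact pair_congr h₁ h₂ (i₁ hr) (conv hr) h₂ (.refl _) h₃ (.refl _) h₄
    | pair_pred _ _ _ hr => exact pair_congr h₁ h₂ h₁ (.refl _) (i₂ hr) (conv hr) h₃ (.refl _) h₄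
    | pair_elem _ _ _ hr => exact pair_congr h₁ h₂ h₁ (.refl _) h₂ (.refl _) (i₃ hr) (conv hr) h₄
    | pair_proof _ _ _ hr => exact mk_pair h₁ h₂ h₃ (i₄ hr)
  | fst h₁ h₂ h₃ i₁ i₂ i₃ =>
    cases hr with
    | root hr =>
      obtain hr | ⟨t₀, u₀, t₁, u₁, m, q⟩ := hr
      · cases hr
      -- the type arguments of `fst` and `pair` are convertible by injectivity of `psub`
      obtain ⟨_, _, hm, _, c⟩ := h₃.pair_inv
      exact .conv hm h₁ c.psub_inj.1
    | fst_type _ _ hr => exact fst_congr h₁ (i₁ hr) (conv hr) h₂ (.refl _) h₃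
    | fst_pred _ _ hr => exact fst_congr h₁ h₁ (.refl _) (i₂ hr) (conv hr) h₃
    | fst_arg _ _ hr => exact mk_fst h₁ h₂ (i₃ hr)
  | snd h₁ h₂ h₃ i₁ i₂ i₃ =>
    cases hr with
    | root hr => obtain hr | hr := hr <;> cases hr
    | snd_type _ _ hr => exact snd_congr h₁ h₂ h₃ (i₁ hr) (conv hr) h₂ (.refl _) h₃ (.refl _)
    | snd_pred _ _ hr => exact snd_congr h₁ h₂ h₃ h₁ (.refl _) (i₂ hr) (conv hr) h₃ (.refl _)
    | snd_arg _ _ hr => exact snd_congr h₁ h₂ h₃ h₁ (.refl _) h₂ (.refl _) (i₃ hr) (conv hr)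

theorem HasType.reds {Γ : Ctx} {M M' T : Term} (h : HasType Γ M T) (hr : Reds M M') :
    HasType Γ M' T := by
  induction hr with
  | refl => exact h
  | tail _ hr ih => exact ih.red (red_iff.1 hr)

/-! ### Typed proof irrelevance -/

/-- Proof irrelevance steps between terms that have the type `T` in `Γ`, in any number. -/
def PiPath (Γ : Ctx) (T : Term) : Term → Term → Prop :=
  Relation.ReflTransGen fun M N => HasType Γ M T ∧ HasType Γ N T ∧ PiStep M N

namespace PiPath

variable {Γ Δ : Ctx} {S T M N : Term}

theorem conv (h : PiPath Γ T M N) : Conv M N := by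
  induction h with
  | refl => exact .refl _
  | tail _ h ih => exact ih.trans (.of_piStep h.2.2)

/-- A path is mapped by a one-hole context that preserves typability at the terms of the path. -/
theorem map (h : PiPath Γ T M N) {f : Term → Term}
    (ht : ∀ X, HasType Γ X T → Conv M X → HasType Δ (f X) S)
    (hf : ∀ X Y, PiStep X Y → PiStep (f X) (f Y)) : PiPath Δ S (f M) (f N) := by
  induction h with
  | refl => exact .refl
  | tail h h' ih =>
    have c := conv h
    exact ih.tail ⟨ht _ h'.1 c, ht _ h'.2.1 (c.trans (.of_piStep h'.2.2)), hf _ _ h'.2.2⟩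

theorem restrict (h : PiPath Γ T M N) {P : Term → Prop} (hP : ∀ X, HasType Γ X T → P X) :
    Relation.ReflTransGen (Restrict P PiStep) M N :=
  Relation.ReflTransGen.mono (fun _ _ h => ⟨hP _ h.1, hP _ h.2.1, h.2.2⟩) _ _ h

end PiPath

/-- Two terms with the same erasure that are typable in the same context are related by proof
irrelevance steps between terms of the same type. The subterms are replaced from left to right; at
a pair, the proof of the second term is put in last, in one step. -/
theorem HasType.piPath {Γ : Ctx} {M T M' T' : Term} (h : HasType Γ M T) (h' : HasType Γ M' T')
    (e : M.erase = M'.erase) : PiPath Γ T M M' ∧ HasType Γ M' T := by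
  induction h using HasType.ind generalizing M' T' with
  | var w hl => cases M' <;> simp [erase] at e; subst e; exact ⟨.refl, .var w hl⟩
  | sort w a => cases M' <;> simp [erase] at e; subst e; exact ⟨.refl, .sort w a⟩
  | conv _ h₂ c i₁ =>
    obtain ⟨p, t⟩ := i₁ h' e
    exact ⟨p.map (f := fun X => X) (fun _ h _ => .conv h h₂ c) fun _ _ h => h, .conv t h₂ c⟩
  | prod r h₁ h₂ i₁ i₂ =>
    cases M' <;> simp [erase] at e
    obtain ⟨s₁, s₂, _, _, k₁, k₂⟩ := h'.pi_inv
    obtain ⟨p₁, t₁⟩ := i₁ k₁ e.1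
    obtain ⟨p₂, t₂⟩ := i₂ (k₂.conv_ctx h₁ p₁.conv.symm) e.2
    exact ⟨(p₁.map (fun _ h c => pi_congr r h c h₂) fun _ _ => .pi_dom _).trans
      (p₂.map (fun _ h _ => pi_congr r t₁ p₁.conv h) fun _ _ => .pi_cod _),
      pi_congr r t₁ p₁.conv t₂⟩
  | abst r h₁ h₂ h₃ i₁ _ i₃ =>
    cases M' <;> simp [erase] at e
    obtain ⟨U', s, hP, k₃, _⟩ := h'.lam_inv
    obtain ⟨s₁, _, _, _, k₁, _⟩ := hP.pi_inv
    obtain ⟨p₁, t₁⟩ := i₁ k₁ e.1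
    obtain ⟨p₂, t₂⟩ := i₃ (k₃.conv_ctx h₁ p₁.conv.symm) e.2
    exact ⟨(p₁.map (fun _ h c => lam_congr r h₁ h₂ h c h₃) fun _ _ => .lam_dom _).trans
      (p₂.map (fun _ h _ => lam_congr r h₁ h₂ t₁ p₁.conv h) fun _ _ => .lam_body _),
      lam_congr r h₁ h₂ t₁ p₁.conv t₂⟩
  | app h₁ h₂ i₁ i₂ =>
    cases M' <;> simp [erase] at e
    obtain ⟨_, _, k₁, k₂⟩ := h'.app_inv
    obtain ⟨p₁, t₁⟩ := i₁ k₁ e.1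
    obtain ⟨p₂, t₂⟩ := i₂ k₂ e.2
    exact ⟨(p₁.map (fun _ h _ => .app h h₂) fun _ _ => .app_left _).trans
      (p₂.map (fun _ h c => app_congr t₁ h₂ h c) fun _ _ => .app_right _),
      app_congr t₁ h₂ t₂ p₂.conv⟩
  | psub h₁ h₂ i₁ i₂ =>
    cases M' <;> simp [erase] at e
    obtain ⟨k₁, k₂⟩ := h'.psub_inv
    obtain ⟨p₁, t₁⟩ := i₁ k₁ e.1
    obtain ⟨p₂, t₂⟩ := i₂ k₂ e.2
    exact ⟨(p₁.map (fun _ h c => psub_congr h c h₂) fun _ _ => .psub_type _).trans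
      (p₂.map (fun _ h _ => psub_congr t₁ p₁.conv h) fun _ _ => .psub_pred _),
      psub_congr t₁ p₁.conv t₂⟩
  | pair h₁ h₂ h₃ h₄ i₁ i₂ i₃ _ =>
    cases M' <;> simp [erase] at e
    obtain ⟨k₁, k₂, k₃, k₄, _⟩ := h'.pair_inv
    obtain ⟨p₁, t₁⟩ := i₁ k₁ e.1
    obtain ⟨p₂, t₂⟩ := i₂ k₂ e.2.1
    obtain ⟨p₃, t₃⟩ := i₃ k₃ e.2.2
    have t₄ := k₄.conv (app_pred h₂ h₃) (p₂.conv.app p₃.conv)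
    have tt {q} := pair_congr (h' := q) h₁ h₂ t₁ p₁.conv t₂ p₂.conv t₃ p₃.conv
    exact ⟨(((p₁.map (fun _ h c => pair_congr h₁ h₂ h c h₂ (.refl _) h₃ (.refl _) h₄)
        fun _ _ => .pair_type _ _ _).trans
      (p₂.map (fun _ h c => pair_congr h₁ h₂ t₁ p₁.conv h c h₃ (.refl _) h₄)
        fun _ _ => .pair_pred _ _ _)).trans
      (p₃.map (fun _ h c => pair_congr h₁ h₂ t₁ p₁.conv t₂ p₂.conv h c h₄)
        fun _ _ => .pair_elem _ _ _)).tail ⟨tt h₄, tt t₄, .root (.mk _ _ _ _ _)⟩, tt t₄⟩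
  | fst h₁ h₂ h₃ i₁ i₂ i₃ =>
    cases M' <;> simp [erase] at e
    obtain ⟨k₁, k₂, k₃⟩ := h'.fst_inv
    obtain ⟨p₁, t₁⟩ := i₁ k₁ e.1
    obtain ⟨p₂, t₂⟩ := i₂ k₂ e.2.1
    obtain ⟨p₃, t₃⟩ := i₃ k₃ e.2.2
    exact ⟨((p₁.map (fun _ h c => fst_congr h₁ h c h₂ (.refl _) h₃)
        fun _ _ => .fst_type _ _).trans
      (p₂.map (fun _ h c => fst_congr h₁ t₁ p₁.conv h c h₃) fun _ _ => .fst_pred _ _)).trans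
      (p₃.map (fun _ h _ => fst_congr h₁ t₁ p₁.conv t₂ p₂.conv h) fun _ _ => .fst_arg _ _),
      fst_congr h₁ t₁ p₁.conv t₂ p₂.conv t₃⟩
  | snd h₁ h₂ h₃ i₁ i₂ i₃ =>
    cases M' <;> simp [erase] at e
    obtain ⟨k₁, k₂, k₃⟩ := h'.snd_inv
    obtain ⟨p₁, t₁⟩ := i₁ k₁ e.1
    obtain ⟨p₂, t₂⟩ := i₂ k₂ e.2.1
    obtain ⟨p₃, t₃⟩ := i₃ k₃ e.2.2
    have tt {T' p' m'} := @snd_congr _ _ T' _ p' _ m' h₁ h₂ h₃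
    exact ⟨((p₁.map (fun _ h c => tt h c h₂ (.refl _) h₃ (.refl _))
        fun _ _ => .snd_type _ _).trans
      (p₂.map (fun _ h c => tt t₁ p₁.conv h c h₃ (.refl _)) fun _ _ => .snd_pred _ _)).trans
      (p₃.map (fun _ h c => tt t₁ p₁.conv t₂ p₂.conv h c) fun _ _ => .snd_arg _ _),
      tt t₁ p₁.conv t₂ p₂.conv t₃ p₃.conv⟩

/-! ### Canonical proofs from a contradiction -/

/-- The false proposition `Π P : Prop. P`. -/
def falsity : Term := pi (sort Srt.prop) (var 0)

theorem HasType.falsity {Γ : Ctx} (h : WF Γ) : HasType Γ falsity (.sort .prop) :=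
  have hP := HasType.sort h .prop_type
  .prod .type_prop hP (.var (.decl hP) (.zero _ _))

/-- The term `M` in which the proof in every pair `pair T p m h` is replaced by the variable `k`
applied to the proposition `p m`; the index `k` is that of the variable outside of `M`. -/
def Term.fill : ℕ → Term → Term
  | _, sort s => sort s
  | _, var n => var n
  | k, app M N => app (M.fill k) (N.fill k)
  | k, lam T M => lam (T.fill k) (M.fill (k + 1))
  | k, pi T U => pi (T.fill k) (U.fill (k + 1))
  | k, psub T p => psub (T.fill k) (p.fill k)
  | k, pair T p m _ =>
    pair (T.fill k) (p.fill k) (m.fill k) (app (var k) (app (p.fill k) (m.fill k)))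
  | k, fst T p m => fst (T.fill k) (p.fill k) (m.fill k)
  | k, snd T p m => snd (T.fill k) (p.fill k) (m.fill k)

theorem Term.erase_fill (M : Term) (k : ℕ) : (M.fill k).erase = M.erase := by
  induction M generalizing k <;> simp_all [fill, erase]

theorem Term.fill_erase (M : Term) (k : ℕ) : M.erase.fill k = M.fill k := by
  induction M generalizing k <;> simp_all [fill, erase]

theorem Term.fill_eq_of_erase_eq {M N : Term} (h : M.erase = N.erase) (k : ℕ) :
    M.fill k = N.fill k := by
  rw [← fill_erase, h, fill_erase]

theorem Conv.fill (M : Term) (k : ℕ) : Conv M (M.fill k) :=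
  .of_erase_eq (M.erase_fill k).symm

/-- Filling with a variable of type `falsity` preserves typing: that variable, applied to the
proposition `p m`, is a proof of it. -/
theorem HasType.fill {Γ : Ctx} {M T : Term} (h : HasType Γ M T) {k : ℕ}
    (hk : Lookup Γ k PVSCert.falsity) : HasType Γ (M.fill k) T := by
  induction h using HasType.ind generalizing k with
  | var w hl => exact .var w hl
  | sort w a => exact .sort w a
  | conv _ h₂ c i₁ => exact .conv (i₁ hk) h₂ c
  | prod r _ _ i₁ i₂ => exact pi_congr r (i₁ hk) (.fill _ _) (i₂ (.succ _ hk))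
  | abst r h₁ h₂ _ i₁ _ i₃ => exact lam_congr r h₁ h₂ (i₁ hk) (.fill _ _) (i₃ (.succ _ hk))
  | app _ h₂ i₁ i₂ => exact app_congr (i₁ hk) h₂ (i₂ hk) (.fill _ _)
  | psub _ _ i₁ i₂ => exact psub_congr (i₁ hk) (.fill _ _) (i₂ hk)
  | pair h₁ h₂ h₃ _ i₁ i₂ i₃ _ =>
    have hQ := app_pred (i₂ hk) (i₃ hk)
    have hq : HasType _ _ _ := .app (.var h₁.wf hk) hQ
    exact pair_congr h₁ h₂ (i₁ hk) (.fill _ _) (i₂ hk) (.fill _ _) (i₃ hk) (.fill _ _)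
      (hq.conv (app_pred h₂ h₃) (.app (.fill _ _) (.fill _ _)))
  | fst h₁ _ _ i₁ i₂ i₃ => exact fst_congr h₁ (i₁ hk) (.fill _ _) (i₂ hk) (.fill _ _) (i₃ hk)
  | snd h₁ h₂ h₃ i₁ i₂ i₃ =>
    exact snd_congr h₁ h₂ h₃ (i₁ hk) (.fill _ _) (i₂ hk) (.fill _ _) (i₃ hk) (.fill _ _)

theorem Lookup.append {Γ : Ctx} {n : ℕ} {A : Term} (h : Lookup Γ n A) (Δ : Ctx) :
    Lookup (Γ ++ Δ) n A := by
  induction h with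
  | zero => exact .zero _ _
  | succ U _ ih => exact .succ U ih

theorem WF.append {Γ Δ : Ctx} (hΓ : WF Γ) (hΔ : WF Δ) : WF (Γ ++ Δ) := by
  induction Γ with
  | nil => exact hΔ
  | cons T Γ ih =>
    obtain ⟨s, hT⟩ := hΓ.exists_sort
    have h := hT.rename (ρ := fun n => n) (ih hT.wf) fun n A hn => by
      rw [rename_id]; exact hn.append Δ
    rw [rename_id] at h
    exact .decl h

/-- Declarations may be added at the outer end of a context: no index changes. -/
theorem HasType.append {Γ Δ : Ctx} {M T : Term} (h : HasType Γ M T) (hΔ : WF Δ) :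
    HasType (Γ ++ Δ) M T := by
  have h := h.rename (ρ := fun n => n) (h.wf.append hΔ) fun n A hn => by
    rw [rename_id]; exact hn.append Δ
  rwa [rename_id, rename_id] at h

theorem wf_replicate_falsity (n : ℕ) : WF (List.replicate n falsity) := by
  induction n with
  | zero => exact .empty
  | succ n ih => exact .decl (.falsity ih)

/-- The outermost variable of the extended context is a proof of `falsity`; the type is closed, so
lifting does not change it. -/
theorem lookup_append_falsity (Γ : Ctx) (n : ℕ) :
    Lookup (Γ ++ List.replicate (n + 1) falsity) (Γ.length + n) falsity := by
  induction Γ with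
  | nil =>
    rw [List.nil_append, List.length_nil, Nat.zero_add]
    induction n with
    | zero => exact .zero _ falsity
    | succ n ih => exact .succ _ ih
  | cons T Γ ih =>
    rw [List.length_cons, Nat.add_right_comm]
    exact .succ T ih

/-- Typable terms with the same erasure, possibly typable in different contexts only, are related
by proof irrelevance steps between typable terms. Both contexts are extended to the same length by
declarations of the type `falsity`, and both terms are related to their common filling by the
outermost variable. -/
theorem Typable.piStep_path {A B : Term} (hA : Typable A) (hB : Typable B)
    (e : A.erase = B.erase) : Relation.ReflTransGen (Restrict Typable PiStep) A B := by
  obtain ⟨Γ, S, hA⟩ := hA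
  obtain ⟨Δ, T, hB⟩ := hB
  have hA₁ := hA.append (wf_replicate_falsity (Δ.length + 1))
  have hB₁ := hB.append (wf_replicate_falsity (Γ.length + 1))
  have hA₂ := hA₁.fill (lookup_append_falsity Γ Δ.length)
  have hB₂ := hB₁.fill (lookup_append_falsity Δ Γ.length)
  have p := (hA₁.piPath hA₂ (A.erase_fill _).symm).1.restrict (P := Typable)
    fun X h => ⟨_, _, h⟩
  have q := (hB₂.piPath hB₁ (B.erase_fill _)).1.restrict (P := Typable) fun X h => ⟨_, _, h⟩
  rw [fill_eq_of_erase_eq e, Nat.add_comm] at p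
  exact p.trans q

/-- Reduction from a term of a set stays in the set, if the set is closed under reduction. -/
theorem Reds.restrict {P : Term → Prop} (hP : ∀ M N, P M → Reds M N → P N) {M N : Term}
    (hM : P M) (h : Reds M N) : Relation.ReflTransGen (Restrict P Red) M N := by
  induction h with
  | refl => exact .refl
  | tail h h' ih => exact ih.tail ⟨hP _ _ hM h, hP _ _ hM (h.tail h'), h'⟩

theorem TypableIn.reds {Γ : Ctx} (M N : Term) (hM : TypableIn Γ M) (h : Reds M N) :
    TypableIn Γ N :=
  hM.imp fun _ hM => hM.reds h

theorem Typable.reds (M N : Term) (hM : Typable M) (h : Reds M N) : Typable N :=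
  hM.imp fun _ hM => TypableIn.reds M N hM h

end PVSCert

theorem mainTheorem2 :
    -- beta and first projection reduction is confluent modulo proof irrelevance
    (∀ M A B : Term, Relation.ReflTransGen Red M A → Relation.ReflTransGen Red M B →
      ∃ A' B' : Term, Relation.ReflTransGen Red A A' ∧ PiEq A' B' ∧
        Relation.ReflTransGen Red B B') ∧
    -- every conversion factors
    (∀ A B : Term, Conv A B →
      ∃ A' B' : Term, Relation.ReflTransGen Red A A' ∧ PiEq A' B' ∧
        Relation.ReflTransGen Red B B') ∧
    -- subject reduction
    (∀ (Γ : Ctx) (M M' T : Term), HasType Γ M T → Red M M' → HasType Γ M' T) ∧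
    -- factorisation through terms typable in a fixed context
    (∀ (Γ : Ctx) (A B : Term), Restrict (TypableIn Γ) Conv A B →
      ∃ A' B' : Term, Relation.ReflTransGen (Restrict (TypableIn Γ) Red) A A' ∧
        Relation.ReflTransGen (Restrict (TypableIn Γ) PiStep) A' B' ∧
        Relation.ReflTransGen (Restrict (TypableIn Γ) Red) B B') ∧
    -- factorisation through terms typable in some context
    (∀ A B : Term, Restrict Typable Conv A B →
      ∃ A' B' : Term, Relation.ReflTransGen (Restrict Typable Red) A A' ∧
        Relation.ReflTransGen (Restrict Typable PiStep) A' B' ∧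
        Relation.ReflTransGen (Restrict Typable Red) B B') := by
  refine ⟨fun M A B hA hB => ?_, fun A B h => ?_, fun Γ M M' T h hr => h.red (red_iff.1 hr),
    fun Γ A B h => ?_, fun A B h => ?_⟩
  · obtain ⟨C, h₁, h₂⟩ := Reds.confluent hA hB
    exact ⟨C, C, h₁, .refl, h₂⟩
  · obtain ⟨A', B', h₁, e, h₂⟩ := h.exists_reds
    exact ⟨A', B', h₁, .of_erase_eq e, h₂⟩
  · obtain ⟨hA, hB, h⟩ := h
    obtain ⟨A', B', h₁, e, h₂⟩ := h.exists_reds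
    obtain ⟨T, hA'⟩ := TypableIn.reds _ _ hA h₁
    obtain ⟨T', hB'⟩ := TypableIn.reds _ _ hB h₂
    exact ⟨A', B', h₁.restrict TypableIn.reds hA,
      (hA'.piPath hB' e).1.restrict fun X h => ⟨T, h⟩, h₂.restrict TypableIn.reds hB⟩
  · obtain ⟨hA, hB, h⟩ := h
    obtain ⟨A', B', h₁, e, h₂⟩ := h.exists_reds
    exact ⟨A', B', h₁.restrict Typable.reds hA,
      Typable.piStep_path (.reds _ _ hA h₁) (.reds _ _ hB h₂) e, h₂.restrict Typable.reds hB⟩
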